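/- Let $K$ be an algebraically closed field, $Q$ a finite quiver, $I\subseteq KQ$ an admissible ideal, and $R$ a set generating $I$ as a two-sided ideal, whose elements are called relations. Let $A$ be a finite-dimensional $K$-algebra that is Morita equivalent to $KQ/I$. A *letter* is an arrow $\alpha$ of $Q$ (direct) or a formal inverse $\bar\alpha$ of an arrow, with source and target interchanged; put $\bar{\bar\alpha}=\alpha$. A *walk* is a word $\alpha_1\cdots\alpha_n$ in the letters with $t(\alpha_i)=s(\alpha_{i+1})$ and $\alpha_{i+1}\neq\overline{\alpha_i}$ for all $i<n$; its inverse is $\overline{\alpha_n}\cdots\overline{\alpha_1}$. A *string* is a walk $w$ such that no path occurring with nonzero coefficient in a relation is a subword of $w$ or of $\overline w$. A *band* is a nonempty word $b=\alpha_1\cdots\alpha_t$ such that every power $b^m$ is a string (so $b$ is cyclic) and $b$ is not a proper power of another word. For a band $b$, $\lambda\in K^*$ and $n\in\mathbb N$, the *band module* $M(b,\lambda,n)$ is the representation of $Q$ with underlying space $V_1\oplus\cdots\oplus V_t$, where $V_i=K^n$ lies over the vertex $s(\alpha_i)$, in which (indices modulo $t$) each $\alpha_i$ contributes to the action of its underlying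 arrow the map $V_i\to V_{i+1}$ (if $\alpha_i$ is direct) or $V_{i+1}\to V_i$ (if $\alpha_i$ is inverse) given by the identity matrix for $i<t$ and by the $n\times n$ Jordan block with eigenvalue $\lambda$ for $i=t$. It is annihilated by $I$, hence a $KQ/I$-module, and is regarded as an $A$-module through the Morita equivalence. A *torsion class* is a class of finitely generated $A$-modules that contains $0$ and is closed under quotients and extensions. A *brick* is a module whose endomorphism ring is a division ring. **Theorem 1.4.** Let $b$ be a band and $\lambda\in K^*$. 1. If a torsion class $\mathcal T$ contains $M(b,\lambda,1)$, then $M(b,\lambda,n)\in\mathcal T$ for all $n\in\mathbb N$. 2. If $M(b,\lambda,1)$ is not a brick and a torsion class $\mathcal T$ contains $M(b,\lambda,1)$, then $M(b,\mu,1)\in\mathcal T$ for all $\mu\in K^*$. 3. If $M(b,\lambda,1)$ is a brick, then there is an infinite family of pairwise distinct torsion classes $\mathcal T_\mu$, $\mu\in K^*$, such that for all $\mu,\eta\in K^*$ the class $\mathcal T_\mu$ contains $M(b,\eta,1)$ if and only if $\eta=\mu$. -/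

import Mathlib

open CategoryTheory

universe u

/-! ### Path algebras and bound quiver algebras -/

/-- A path in a quiver, together with its source and its target. -/
structure QPath (Q : Type u) [Quiver.{u} Q] : Type u where
  src : Q
  tgt : Q
  path : Quiver.Path src tgt

/-- The trivial path at a vertex. -/
def QPath.nil {Q : Type u} [Quiver.{u} Q] (a : Q) : QPath Q := ⟨a, a, Quiver.Path.nil⟩

/-- The number of arrows of a path. -/
def QPath.length {Q : Type u} [Quiver.{u} Q] (p : QPath Q) : ℕ := p.path.length

/-- The vector space `KQ` with basis the paths of `Q`: an element is the finitely supported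
function giving the coefficient of each path. -/
def PathAlgebra (K Q : Type u) [Field K] [Quiver.{u} Q] : Type u := QPath Q →₀ K

namespace PathAlgebra

noncomputable section

variable {K Q : Type u} [Field K] [Quiver.{u} Q]

instance : AddCommGroup (PathAlgebra K Q) := inferInstanceAs (AddCommGroup (QPath Q →₀ K))

instance : Module K (PathAlgebra K Q) := inferInstanceAs (Module K (QPath Q →₀ K))

/-- The set of the paths that occur in `x` with a nonzero coefficient. -/
def support (x : PathAlgebra K Q) : Finset (QPath Q) := Finsupp.support x

/-- The coefficient of a path. -/
def coeff (x : PathAlgebra K Q) (p : QPath Q) : K := (show QPath Q →₀ K from x) p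

/-- A path as an element of the path algebra. -/
def of (p : QPath Q) : PathAlgebra K Q := Finsupp.single p 1

open Classical in
/-- The product of two paths: `mulPath p q` is the path "first `q`, then `p`" if `q` ends where
`p` starts, and `0` otherwise.  With this convention left modules over the path algebra are the
(covariant) representations of the quiver. -/
def mulPath (p q : QPath Q) : PathAlgebra K Q :=
  if h : q.tgt = p.src then of ⟨q.src, p.tgt, (h ▸ q.path : Quiver.Path q.src p.src).comp p.path⟩
  else 0

/-- The linear map out of the path algebra with prescribed values on the paths. -/
def linLift {M : Type*} [AddCommGroup M] [Module K M] (f : QPath Q → M) :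
    PathAlgebra K Q →ₗ[K] M :=
  Finsupp.linearCombination K f

theorem linLift_of {M : Type*} [AddCommGroup M] [Module K M] (f : QPath Q → M) (p : QPath Q) :
    linLift f (of p : PathAlgebra K Q) = f p := by
  rw [linLift, of]
  exact (Finsupp.linearCombination_single K 1 p).trans (one_smul K _)

theorem linLift_eq_sum {M : Type*} [AddCommGroup M] [Module K M] (f : QPath Q → M)
    (x : PathAlgebra K Q) : linLift f x = ∑ p ∈ x.support, x.coeff p • f p := rfl

theorem lin_ext {M : Type*} [AddCommGroup M] [Module K M] {f g : PathAlgebra K Q →ₗ[K] M}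
    (h : ∀ p, f (of p) = g (of p)) : f = g :=
  Finsupp.lhom_ext' fun p => LinearMap.ext_ring (h p)

/-- The multiplication of the path algebra, the bilinear extension of the product of paths. -/
def mulLin : PathAlgebra K Q →ₗ[K] PathAlgebra K Q →ₗ[K] PathAlgebra K Q :=
  linLift fun p => linLift fun q => mulPath p q

instance : Mul (PathAlgebra K Q) := ⟨fun x y => mulLin x y⟩

theorem mul_def (x y : PathAlgebra K Q) : x * y = mulLin x y := rfl

theorem of_mul_of (p q : QPath Q) : (of p * of q : PathAlgebra K Q) = mulPath p q := by
  rw [mul_def, mulLin, linLift_of, linLift_of]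

theorem of_mul_of_comp {a b c : Q} (q : Quiver.Path a b) (p : Quiver.Path b c) :
    (of ⟨b, c, p⟩ * of ⟨a, b, q⟩ : PathAlgebra K Q) = of ⟨a, c, q.comp p⟩ := by
  rw [of_mul_of, mulPath, dif_pos rfl]

theorem of_mul_of_ne {p q : QPath Q} (h : q.tgt ≠ p.src) :
    (of p * of q : PathAlgebra K Q) = 0 := by
  rw [of_mul_of, mulPath, dif_neg h]

theorem of_mul_assoc (p q r : QPath Q) :
    (of p * of q * of r : PathAlgebra K Q) = of p * (of q * of r) := by
  obtain ⟨c, d, p⟩ := p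
  obtain ⟨b, c', q⟩ := q
  obtain ⟨a, b', r⟩ := r
  have z1 : ∀ x : PathAlgebra K Q, x * 0 = 0 := fun x => by rw [mul_def, map_zero]
  have z2 : ∀ x : PathAlgebra K Q, 0 * x = 0 := fun x => by
    rw [mul_def, map_zero, LinearMap.zero_apply]
  by_cases h1 : c' = c
  · subst h1
    rw [of_mul_of_comp]
    by_cases h2 : b' = b
    · subst h2
      rw [of_mul_of_comp, of_mul_of_comp, of_mul_of_comp, Quiver.Path.comp_assoc]
    · rw [of_mul_of_ne h2, of_mul_of_ne h2, z1]
  · rw [of_mul_of_ne (p := ⟨c, d, p⟩) h1, z2]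
    by_cases h2 : b' = b
    · subst h2
      rw [of_mul_of_comp, of_mul_of_ne h1]
    · rw [of_mul_of_ne h2, z1]

theorem ind {P : PathAlgebra K Q → Prop} (hof : ∀ p, P (of p)) (hz : P 0)
    (hadd : ∀ x y, P x → P y → P (x + y)) (hsmul : ∀ (c : K) x, P x → P (c • x))
    (x : PathAlgebra K Q) : P x := by
  refine Finsupp.induction_linear (motive := P) x hz hadd fun p c => ?_
  have h : (Finsupp.single p c : QPath Q →₀ K) = c • Finsupp.single p 1 := by simp
  rw [h]
  exact hsmul c _ (hof p)

instance : NonUnitalRing (PathAlgebra K Q) where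
  left_distrib x y z := by simp only [mul_def, map_add]
  right_distrib x y z := by simp only [mul_def, map_add, LinearMap.add_apply]
  zero_mul x := by simp only [mul_def, map_zero, LinearMap.zero_apply]
  mul_zero x := by simp only [mul_def, map_zero]
  mul_assoc x y z := by
    induction x using ind with
    | hof p =>
      induction y using ind with
      | hof q =>
        induction z using ind with
        | hof r => exact of_mul_assoc p q r
        | hz => simp only [mul_def, map_zero]
        | hadd x y hx hy => simp only [mul_def, map_add] at *; rw [hx, hy]
        | hsmul c x hx => simp only [mul_def, map_smul] at *; rw [hx]
      | hz => simp only [mul_def, map_zero, LinearMap.zero_apply]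
      | hadd x y hx hy => simp only [mul_def, map_add, LinearMap.add_apply] at *; rw [hx, hy]
      | hsmul c x hx => simp only [mul_def, map_smul, LinearMap.smul_apply] at *; rw [hx]
    | hz => simp only [mul_def, map_zero, LinearMap.zero_apply]
    | hadd x y hx hy => simp only [mul_def, map_add, LinearMap.add_apply] at *; rw [hx, hy]
    | hsmul c x hx => simp only [mul_def, map_smul, LinearMap.smul_apply] at *; rw [hx]

variable [Fintype Q]

/-- The unit of the path algebra is the sum of the trivial paths. -/
instance : One (PathAlgebra K Q) := ⟨∑ a : Q, of (QPath.nil a)⟩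

theorem one_def : (1 : PathAlgebra K Q) = ∑ a : Q, of (QPath.nil a) := rfl

theorem one_mul_of (p : QPath Q) : (1 * of p : PathAlgebra K Q) = of p := by
  obtain ⟨a, b, p⟩ := p
  rw [one_def, Finset.sum_mul, Finset.sum_eq_single b]
  · exact of_mul_of_comp p Quiver.Path.nil
  · exact fun c _ hc => of_mul_of_ne (p := QPath.nil c) (q := ⟨a, b, p⟩) (Ne.symm hc)
  · exact fun h => absurd (Finset.mem_univ b) h

theorem of_mul_one (p : QPath Q) : (of p * 1 : PathAlgebra K Q) = of p := by
  obtain ⟨a, b, p⟩ := p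
  rw [one_def, Finset.mul_sum, Finset.sum_eq_single a]
  · exact (of_mul_of_comp Quiver.Path.nil p).trans (by rw [Quiver.Path.nil_comp])
  · exact fun c _ hc => of_mul_of_ne (p := ⟨a, b, p⟩) (q := QPath.nil c) hc
  · exact fun h => absurd (Finset.mem_univ a) h

instance : Ring (PathAlgebra K Q) :=
  { (inferInstance : NonUnitalRing (PathAlgebra K Q)), (inferInstance : One (PathAlgebra K Q)) with
    one_mul := fun x => by
      have h : mulLin (1 : PathAlgebra K Q) = LinearMap.id := lin_ext one_mul_of
      exact LinearMap.congr_fun h x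
    mul_one := fun x => by
      have h : mulLin.flip (1 : PathAlgebra K Q) = LinearMap.id := lin_ext of_mul_one
      exact LinearMap.congr_fun h x }

instance : Algebra K (PathAlgebra K Q) :=
  Algebra.ofModule
    (fun c x y => by simp only [mul_def, map_smul, LinearMap.smul_apply])
    (fun c x y => by simp only [mul_def, map_smul])

section lift

variable {B : Type*} [Ring B] [Algebra K B] (E : Q → B) (X : Quiver.Total Q → B)

/-- The product of the elements assigned to the arrows of a path (`E a` for the trivial path at
`a`), later arrows on the left. -/
def evalPath {a : Q} : {b : Q} → Quiver.Path a b → B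
  | _, Quiver.Path.nil => E a
  | _, Quiver.Path.cons p f => X ⟨_, _, f⟩ * evalPath p

/-- The algebra homomorphism out of the path algebra given by a complete family `E` of orthogonal
idempotents indexed by the vertices and by elements `X f` for the arrows `f : a ⟶ b`, with
`E b * X f = X f`: it sends the trivial path at `a` to `E a` and the arrow `f` to `X f * E a`. -/
def lift (hE : ∀ a, E a * E a = E a) (hE' : ∀ a b, a ≠ b → E a * E b = 0) (hsum : ∑ a, E a = 1)
    (hl : ∀ f, E f.right * X f = X f) :
    PathAlgebra K Q →ₐ[K] B :=
  have el : ∀ {a b : Q} (p : Quiver.Path a b), E b * evalPath E X p = evalPath E X p := by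
    intro a b p
    cases p with
    | nil => exact hE a
    | cons p f => rw [evalPath, ← mul_assoc, hl ⟨_, _, f⟩]
  have er : ∀ {a b : Q} (p : Quiver.Path a b), evalPath E X p * E a = evalPath E X p := by
    intro a b p
    induction p with
    | nil => exact hE a
    | cons p f ih => rw [evalPath, mul_assoc, ih]
  have ec : ∀ {a b c : Q} (q : Quiver.Path a b) (p : Quiver.Path b c),
      evalPath E X (q.comp p) = evalPath E X p * evalPath E X q := by
    intro a b c q p
    induction p with
    | nil => rw [Quiver.Path.comp_nil]; exact (el q).symm
    | cons p f ih => rw [Quiver.Path.comp_cons, evalPath, ih, evalPath, mul_assoc]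
  AlgHom.ofLinearMap (linLift fun p => evalPath E X p.path)
    (by rw [one_def, map_sum, ← hsum]; exact Finset.sum_congr rfl fun a _ => linLift_of _ _)
    (fun x y => by
      have key : ∀ p q : QPath Q,
          linLift (fun p => evalPath E X p.path) (of p * of q : PathAlgebra K Q) =
            evalPath E X p.path * evalPath E X q.path := by
        rintro ⟨b, c, p⟩ ⟨a, b', q⟩
        by_cases h : b' = b
        · subst h
          rw [of_mul_of_comp, linLift_of]
          exact ec q p
        · rw [of_mul_of_ne h, map_zero, ← er p, ← el q, mul_assoc, ← mul_assoc (E b),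
            hE' b b' (Ne.symm h), zero_mul, mul_zero]
      induction x using ind with
      | hof p =>
        induction y using ind with
        | hof q => rw [key, linLift_of, linLift_of]
        | hz => rw [mul_zero, map_zero, mul_zero]
        | hadd x y hx hy => rw [mul_add, map_add, hx, hy, map_add, mul_add]
        | hsmul c x hx => rw [mul_smul_comm, map_smul, hx, map_smul, mul_smul_comm]
      | hz => rw [zero_mul, map_zero, zero_mul]
      | hadd x y hx hy => rw [add_mul, map_add, hx, hy, map_add, add_mul]
      | hsmul c x hx => rw [smul_mul_assoc, map_smul, hx, map_smul, smul_mul_assoc])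

theorem lift_apply (hE hE' hsum hl) (x : PathAlgebra K Q) :
    lift E X hE hE' hsum hl x = linLift (fun p => evalPath E X p.path) x := rfl

end lift

end

end PathAlgebra

/-- A two-sided ideal `I` of `KQ` is admissible if `J ^ N ⊆ I ⊆ J ^ 2` for some `N`, where `J` is
the ideal generated by the arrows; `J ^ m` is the span of the paths of length at least `m`. -/
def IsAdmissible {K Q : Type u} [Field K] [Quiver.{u} Q] [Fintype Q]
    (I : TwoSidedIdeal (PathAlgebra K Q)) : Prop :=
  (∀ x ∈ I, ∀ p ∈ x.support, 2 ≤ p.length) ∧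
    ∃ N : ℕ, ∀ p : QPath Q, N ≤ p.length → PathAlgebra.of p ∈ I

/-- The algebra `KQ/I`, where `I` is the two-sided ideal generated by the set `R` of relations. -/
abbrev BoundQuiverAlgebra {K Q : Type u} [Field K] [Quiver.{u} Q] [Fintype Q]
    (R : Set (PathAlgebra K Q)) : Type u :=
  (TwoSidedIdeal.span R).ringCon.Quotient

/-! ### Walks, strings and bands -/

/-- A letter: an arrow of the quiver (`direct = true`) or the formal inverse of an arrow
(`direct = false`). -/
@[ext]
structure Letter (Q : Type u) [Quiver.{u} Q] : Type u where
  arrow : Quiver.Total Q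
  direct : Bool

namespace Letter

variable {Q : Type u} [Quiver.{u} Q]

/-- The vertex where a letter starts. -/
def src (x : Letter Q) : Q := if x.direct then x.arrow.left else x.arrow.right

/-- The vertex where a letter ends. -/
def tgt (x : Letter Q) : Q := if x.direct then x.arrow.right else x.arrow.left

/-- The formal inverse of a letter. -/
def inv (x : Letter Q) : Letter Q := ⟨x.arrow, !x.direct⟩

end Letter

/-- The word in direct letters given by a path. -/
def Quiver.Path.letters {Q : Type u} [Quiver.{u} Q] {a : Q} :
    {b : Q} → Quiver.Path a b → List (Letter Q)
  | _, Quiver.Path.nil => []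
  | _, Quiver.Path.cons p f => p.letters ++ [⟨⟨_, _, f⟩, true⟩]

/-- The inverse of a word: the inverse letters in the opposite order. -/
def invWord {Q : Type u} [Quiver.{u} Q] (w : List (Letter Q)) : List (Letter Q) :=
  (w.map Letter.inv).reverse

/-- The power `b ^ n` of a word. -/
def wordPow {Q : Type u} [Quiver.{u} Q] (b : List (Letter Q)) (n : ℕ) : List (Letter Q) :=
  (List.replicate n b).flatten

/-- A walk: consecutive letters are composable and not inverse to each other. -/
def IsWalk {Q : Type u} [Quiver.{u} Q] (w : List (Letter Q)) : Prop :=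
  w.IsChain fun x y => x.tgt = y.src ∧ y ≠ x.inv

/-- A string: a walk `w` such that no path that is a summand of a relation is a subword of `w`
or of the inverse of `w`. -/
def IsString {K Q : Type u} [Field K] [Quiver.{u} Q] (R : Set (PathAlgebra K Q))
    (w : List (Letter Q)) : Prop :=
  IsWalk w ∧ ∀ r ∈ R, ∀ p ∈ r.support,
    ¬ p.path.letters <:+: w ∧ ¬ p.path.letters <:+: invWord w

/-- A band: a nonempty word all of whose powers are strings (in particular, it is a cyclic walk)
and which is not a proper power of a word. -/
structure IsBand {K Q : Type u} [Field K] [Quiver.{u} Q] (R : Set (PathAlgebra K Q))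
    (b : List (Letter Q)) : Prop where
  ne_nil : b ≠ []
  isString_pow : ∀ n : ℕ, IsString R (wordPow b n)
  not_pow : ∀ (c : List (Letter Q)) (k : ℕ), 2 ≤ k → wordPow c k ≠ b

/-! ### Band modules -/

/-- The `n × n` Jordan block with eigenvalue `μ`. -/
def jordanBlock {K : Type u} [Field K] (n : ℕ) (μ : K) : Matrix (Fin n) (Fin n) K :=
  Matrix.of fun i j => if i = j then μ else if i.val + 1 = j.val then 1 else 0

namespace Band

noncomputable section

variable {K Q : Type u} [Field K] [Quiver.{u} Q]

/-- The cyclic successor of a position of the word `b`.  The letter at position `i` goes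
from the vertex at position `i` to the vertex at position `next i`. -/
def next {b : List (Letter Q)} (i : Fin b.length) : Fin b.length :=
  ⟨(i.val + 1) % b.length, Nat.mod_lt _ i.pos⟩

/-- The matrix attached to the letter at position `i`: the identity, except for the last
letter of the word, where it is the Jordan block with eigenvalue `μ`. -/
def letterMat (b : List (Letter Q)) (μ : K) (n : ℕ) (i : Fin b.length) :
    (Fin n → K) →ₗ[K] (Fin n → K) :=
  if i.val + 1 = b.length then Matrix.toLin' (jordanBlock n μ) else LinearMap.id

/-- The underlying vector space: a copy of `K ^ n` for each vertex of the cyclic word `b`. -/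
abbrev Space (K : Type u) (b : List (Letter Q)) (n : ℕ) : Type u := Fin b.length → Fin n → K

open Classical in
/-- The idempotent of the vertex `a` of the quiver acts as the projection to the copies
of `K ^ n` that lie over `a`. -/
def vertexOp (b : List (Letter Q)) (n : ℕ) (a : Q) : Module.End K (Space K b n) :=
  LinearMap.pi fun i => if (b.get i).src = a then LinearMap.proj i else 0

open Classical in
/-- The arrow `f` of the quiver acts along the occurrences of `f` and of its inverse in `b`: if
the letter at position `i` is `f`, through the matrix at `i` from the copy at `i` to the copy at
`next i`; if it is the inverse of `f`, through the matrix at `i` from the copy at `next i` to the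
copy at `i`. -/
def arrowOp (b : List (Letter Q)) (μ : K) (n : ℕ) (f : Quiver.Total Q) :
    Module.End K (Space K b n) :=
  ∑ i : Fin b.length,
    ((if b.get i = ⟨f, true⟩ then
        (LinearMap.single K (fun _ => Fin n → K) (next i)) ∘ₗ letterMat b μ n i ∘ₗ
          (LinearMap.proj i) else 0) +
      (if b.get i = ⟨f, false⟩ then
        (LinearMap.single K (fun _ => Fin n → K) i) ∘ₗ letterMat b μ n i ∘ₗ
          (LinearMap.proj (next i)) else 0))

open Classical in
theorem vertexOp_apply (b : List (Letter Q)) (n : ℕ) (a : Q) (x : Space K b n)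
    (i : Fin b.length) : vertexOp b n a x i = if (b.get i).src = a then x i else 0 := by
  rw [vertexOp, LinearMap.pi_apply]
  split_ifs <;> rfl

theorem vertexOp_idem (b : List (Letter Q)) (n : ℕ) (a : Q) :
    vertexOp b n a * vertexOp b n a = (vertexOp b n a : Module.End K (Space K b n)) := by
  refine LinearMap.ext fun x => funext fun i => ?_
  rw [Module.End.mul_apply, vertexOp_apply, vertexOp_apply]
  split_ifs <;> rfl

theorem vertexOp_orth (b : List (Letter Q)) (n : ℕ) (a c : Q) (h : a ≠ c) :
    vertexOp b n a * vertexOp b n c = (0 : Module.End K (Space K b n)) := by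
  refine LinearMap.ext fun x => funext fun i => ?_
  rw [Module.End.mul_apply, vertexOp_apply, vertexOp_apply]
  split_ifs with h1 h2
  · exact absurd (h1.symm.trans h2) h
  · rfl
  · rfl

theorem vertexOp_sum [Fintype Q] (b : List (Letter Q)) (n : ℕ) :
    ∑ a : Q, vertexOp b n a = (1 : Module.End K (Space K b n)) := by
  classical
  refine LinearMap.ext fun x => funext fun i => ?_
  rw [LinearMap.sum_apply, Finset.sum_apply]
  simp only [vertexOp_apply]
  rw [Finset.sum_ite_eq]
  simp

open Classical in
theorem arrowOp_ne_zero {b : List (Letter Q)} {μ : K} {n : ℕ} {f : Quiver.Total Q}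
    {x : Space K b n} {j : Fin b.length} (h : arrowOp b μ n f x j ≠ 0) :
    ∃ i, (b.get i = ⟨f, true⟩ ∧ next i = j ∧ x i ≠ 0) ∨
      (b.get i = ⟨f, false⟩ ∧ i = j ∧ x (next i) ≠ 0) := by
  rw [arrowOp, LinearMap.sum_apply, Finset.sum_apply] at h
  obtain ⟨i, -, hi⟩ := Finset.exists_ne_zero_of_sum_ne_zero h
  refine ⟨i, ?_⟩
  by_contra hc
  push Not at hc
  apply hi
  rw [LinearMap.add_apply, Pi.add_apply]
  have h1 : (if b.get i = ⟨f, true⟩ then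
        (LinearMap.single K (fun _ => Fin n → K) (next i)) ∘ₗ letterMat b μ n i ∘ₗ
          (LinearMap.proj i) else 0 : Module.End K (Space K b n)) x j = 0 := by
    split_ifs with hf
    · change (Pi.single (next i) (letterMat b μ n i (x i)) : Space K b n) j = 0
      by_cases hj : next i = j
      · rw [hc.1 hf hj, map_zero, Pi.single_zero, Pi.zero_apply]
      · exact Pi.single_eq_of_ne (Ne.symm hj) _
    · rfl
  have h2 : (if b.get i = ⟨f, false⟩ then
        (LinearMap.single K (fun _ => Fin n → K) i) ∘ₗ letterMat b μ n i ∘ₗ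
          (LinearMap.proj (next i)) else 0 : Module.End K (Space K b n)) x j = 0 := by
    split_ifs with hf
    · change (Pi.single i (letterMat b μ n i (x (next i))) : Space K b n) j = 0
      by_cases hj : i = j
      · rw [hc.2 hf hj, map_zero, Pi.single_zero, Pi.zero_apply]
      · exact Pi.single_eq_of_ne (Ne.symm hj) _
    · rfl
  rw [h1, h2, add_zero]

/-- The letter at position `m` of the periodic word `b b b ⋯`. -/
def letterAt (b : List (Letter Q)) (hb : 0 < b.length) (m : ℕ) : Letter Q :=
  b.get ⟨m % b.length, Nat.mod_lt _ hb⟩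

theorem map_letterAt_range (b : List (Letter Q)) (hb : 0 < b.length) :
    (List.range b.length).map (letterAt b hb) = b := by
  refine List.ext_getElem (by simp) fun i h1 h2 => ?_
  simp [letterAt, Nat.mod_eq_of_lt h2]

theorem wordPow_eq (b : List (Letter Q)) (hb : 0 < b.length) (N : ℕ) :
    wordPow b N = (List.range (N * b.length)).map (letterAt b hb) := by
  induction N with
  | zero => simp [wordPow]
  | succ N ih =>
    have h : wordPow b (N + 1) = b ++ wordPow b N := by
      simp [wordPow, List.replicate_succ]
    rw [h, ih, Nat.succ_mul, Nat.add_comm, List.range_add, List.map_append,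
      map_letterAt_range, List.map_map]
    congr 1
    refine List.map_congr_left fun k _ => ?_
    simp [letterAt]

theorem infix_wordPow (b : List (Letter Q)) (hb : 0 < b.length) (m l : ℕ) :
    (List.range' m l).map (letterAt b hb) <:+: wordPow b (m + l) := by
  obtain ⟨k, hk⟩ := Nat.exists_eq_add_of_le (Nat.le_mul_of_pos_right (m + l) hb)
  rw [wordPow_eq b hb, hk]
  refine List.IsInfix.map _ ⟨List.range' 0 m, List.range' (m + l) k, ?_⟩
  have h1 : List.range' 0 m ++ List.range' m l = List.range' 0 (m + l) := by
    simpa using List.range'_append_1 (s := 0) (m := m) (n := l)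
  have h2 : List.range' 0 (m + l) ++ List.range' (m + l) k = List.range' 0 (m + l + k) := by
    simpa using List.range'_append_1 (s := 0) (m := m + l) (n := k)
  rw [h1, h2, List.range_eq_range']

theorem letters_direct {a c : Q} (p : Quiver.Path a c) : ∀ x ∈ p.letters, x.direct = true := by
  induction p with
  | nil => intro x hx; simp [Quiver.Path.letters] at hx
  | cons p f ih =>
    intro x hx
    rw [Quiver.Path.letters, List.mem_append, List.mem_singleton] at hx
    rcases hx with hx | rfl
    · exact ih x hx
    · rfl

section

variable {R : Set (PathAlgebra K Q)} {b : List (Letter Q)}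

theorem length_pos (hb : IsBand R b) : 0 < b.length := List.length_pos_iff.mpr hb.ne_nil

theorem tgt_eq (hb : IsBand R b) (i : Fin b.length) : (b.get i).tgt = (b.get (next i)).src := by
  have h := (hb.isString_pow (i.val + 2)).1.infix (infix_wordPow b (length_pos hb) i.val 2)
  simp only [List.range'_succ, List.map_cons, List.isChain_cons_cons] at h
  have h' := h.1.1
  simp only [letterAt, Nat.mod_eq_of_lt i.isLt] at h'
  exact h'

theorem vertexOp_arrowOp (hb : IsBand R b) (μ : K) (n : ℕ) (f : Quiver.Total Q) :
    vertexOp b n f.right * arrowOp b μ n f = arrowOp b μ n f := by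
  refine LinearMap.ext fun x => funext fun j => ?_
  rw [Module.End.mul_apply, vertexOp_apply]
  split_ifs with h
  · rfl
  · by_contra hc
    obtain ⟨i, ⟨h1, h2, -⟩ | ⟨h1, h2, -⟩⟩ := arrowOp_ne_zero (Ne.symm hc)
    · apply h
      rw [← h2, ← tgt_eq hb, h1]
      rfl
    · apply h
      rw [← h2, h1]
      rfl

/-- The action of the path algebra on the space of the band module. -/
def pathRep [Fintype Q] (hb : IsBand R b) (μ : K) (n : ℕ) :
    PathAlgebra K Q →ₐ[K] Module.End K (Space K b n) :=
  PathAlgebra.lift (vertexOp b n) (arrowOp b μ n) (vertexOp_idem b n) (vertexOp_orth b n)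
    (vertexOp_sum b n) (vertexOp_arrowOp hb μ n)

/-- A path that acts nontrivially can be read along the periodic word, forwards or backwards. -/
theorem evalPath_ne_zero (hb : IsBand R b) (μ : K) (n : ℕ) {a c : Q} (p : Quiver.Path a c)
    (x : Space K b n) (j : Fin b.length)
    (h : PathAlgebra.evalPath (vertexOp b n) (arrowOp b μ n) p x j ≠ 0) :
    (∃ m l : ℕ, (m + l) % b.length = j.val ∧
        p.letters = (List.range' m l).map (letterAt b (length_pos hb))) ∨
      (∃ m l : ℕ, m % b.length = j.val ∧
        p.letters = invWord ((List.range' m l).map (letterAt b (length_pos hb)))) := by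
  have hat : ∀ (m : ℕ) (i : Fin b.length), m % b.length = i.val →
      letterAt b (length_pos hb) m = b.get i := by
    intro m i hi
    simp only [letterAt, hi]
  induction p generalizing j with
  | nil => exact Or.inl ⟨j.val, 0, by simp [Nat.mod_eq_of_lt j.isLt], by simp [Quiver.Path.letters]⟩
  | cons p f ih =>
    have hdir := letters_direct p
    obtain ⟨i, ⟨h1, h2, h3⟩ | ⟨h1, h2, h3⟩⟩ := arrowOp_ne_zero h
    · left
      have fwd : ∃ m l : ℕ, (m + l) % b.length = i.val ∧
          p.letters = (List.range' m l).map (letterAt b (length_pos hb)) := by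
        rcases ih i h3 with hm | ⟨m, l, hm, hp⟩
        · exact hm
        · rcases l with _ | l
          · exact ⟨m, 0, by simpa using hm, by simpa [invWord] using hp⟩
          · exfalso
            have := hdir (letterAt b (length_pos hb) m).inv (by
              rw [hp]
              simp [invWord, List.range'_succ])
            rw [hat m i hm, h1] at this
            simp [Letter.inv] at this
      obtain ⟨m, l, hm, hp⟩ := fwd
      refine ⟨m, l + 1, ?_, ?_⟩
      · rw [← h2, ← Nat.add_assoc, next, Nat.add_mod, hm]
        simp
      · rw [Quiver.Path.letters, hp, List.range'_1_concat, List.map_append, List.map_singleton,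
          hat _ i hm, h1]
    · right
      subst h2
      have hj1 : (i.val + 1) % b.length = (next i).val := rfl
      have bwd : ∃ m l : ℕ, m % b.length = (next i).val ∧
          p.letters = invWord ((List.range' m l).map (letterAt b (length_pos hb))) := by
        rcases ih (next i) h3 with ⟨m, l, hm, hp⟩ | hm
        · rcases l with _ | l
          · exact ⟨m, 0, by simpa using hm, by simpa [invWord] using hp⟩
          · exfalso
            have := hdir (letterAt b (length_pos hb) (m + l)) (by
              rw [hp, List.range'_1_concat]
              simp)
            rw [hat (m + l) i (by
              rw [← hj1, ← Nat.add_assoc] at hm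
              have h4 : m + l ≡ i.val [MOD b.length] := Nat.ModEq.add_right_cancel' 1 hm
              rwa [Nat.ModEq, Nat.mod_eq_of_lt i.isLt] at h4), h1] at this
            simp at this
        · exact hm
      obtain ⟨m, l, hm, hp⟩ := bwd
      refine ⟨i.val, l + 1, Nat.mod_eq_of_lt i.isLt, ?_⟩
      have hshift : (List.range' (i.val + 1) l).map (letterAt b (length_pos hb)) =
          (List.range' m l).map (letterAt b (length_pos hb)) := by
        rw [List.range'_eq_map_range, List.range'_eq_map_range, List.map_map, List.map_map]
        refine List.map_congr_left fun k _ => ?_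
        simp only [Function.comp_apply, letterAt]
        congr 2
        exact Nat.ModEq.add_right k (hj1.trans hm.symm)
      rw [Quiver.Path.letters, hp, List.range'_succ, List.map_cons, hshift,
        hat i.val i (Nat.mod_eq_of_lt i.isLt), h1]
      simp [invWord, Letter.inv]

theorem evalPath_eq_zero (hb : IsBand R b) (μ : K) (n : ℕ) {r : PathAlgebra K Q} (hr : r ∈ R)
    {p : QPath Q} (hp : p ∈ r.support) :
    PathAlgebra.evalPath (vertexOp b n) (arrowOp b μ n) p.path = 0 := by
  refine LinearMap.ext fun x => funext fun j => ?_
  by_contra hc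
  rcases evalPath_ne_zero hb μ n p.path x j hc with ⟨m, l, -, h⟩ | ⟨m, l, -, h⟩
  · refine ((hb.isString_pow (m + l)).2 r hr p hp).1 ?_
    rw [h]
    exact infix_wordPow b (length_pos hb) m l
  · refine ((hb.isString_pow (m + l)).2 r hr p hp).2 ?_
    rw [h]
    exact List.reverse_infix.mpr ((infix_wordPow b (length_pos hb) m l).map _)

variable [Fintype Q]

theorem span_le_ker (hb : IsBand R b) (μ : K) (n : ℕ) :
    TwoSidedIdeal.span R ≤ TwoSidedIdeal.ker (pathRep hb μ n) := by
  refine TwoSidedIdeal.span_le.mpr fun r hr => ?_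
  change r ∈ TwoSidedIdeal.ker (pathRep hb μ n)
  rw [TwoSidedIdeal.mem_ker, pathRep, PathAlgebra.lift_apply, PathAlgebra.linLift_eq_sum]
  exact Finset.sum_eq_zero fun p hp => by rw [evalPath_eq_zero hb μ n hr hp, smul_zero]

/-- The action of `KQ/I` on the space of the band module. -/
def rep (hb : IsBand R b) (μ : K) (n : ℕ) :
    BoundQuiverAlgebra R →+* Module.End K (Space K b n) :=
  (TwoSidedIdeal.span R).ringCon.lift (pathRep hb μ n : PathAlgebra K Q →+* _)
    fun x y h => by
      have h' := span_le_ker hb μ n ((TwoSidedIdeal.rel_iff _ x y).mp h)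
      rw [TwoSidedIdeal.mem_ker, map_sub, sub_eq_zero] at h'
      exact h'

end

end

end Band

/-- The band module `M(b, μ, n)` over `KQ/I`, where `I` is generated by `R`. -/
noncomputable def bandModule {K Q : Type u} [Field K] [Quiver.{u} Q] [Fintype Q]
    {R : Set (PathAlgebra K Q)} {b : List (Letter Q)} (hb : IsBand R b) (μ : Kˣ) (n : ℕ) :
    ModuleCat.{u} (BoundQuiverAlgebra R) :=
  letI : Module (BoundQuiverAlgebra R) (Band.Space K b n) :=
    Module.compHom (Band.Space K b n) (Band.rep hb (μ : K) n)
  ModuleCat.of (BoundQuiverAlgebra R) (Band.Space K b n)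

/-! ### Bricks and torsion classes -/

/-- A brick: an object whose endomorphism ring is a division ring. -/
structure IsBrick {C : Type*} [Category C] [Preadditive C] (X : C) : Prop where
  nontrivial : Nontrivial (End X)
  isUnit : ∀ f : End X, f ≠ 0 → IsUnit f

/-- A torsion class in the category of finitely generated modules over a ring: a class of finitely
generated modules that contains zero and is closed under quotients and extensions. -/
structure IsTorsionClass {A : Type u} [Ring A] (T : ObjectProperty (ModuleCat.{u} A)) : Prop where
  finite : ∀ M : ModuleCat.{u} A, T M → Module.Finite A M
  zero : T.ContainsZero
  quotients : T.IsClosedUnderQuotients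
  extensions : T.IsClosedUnderExtensions

namespace Band

noncomputable section

variable {K Q : Type u} [Field K] [Quiver.{u} Q] {R : Set (PathAlgebra K Q)}
  {b : List (Letter Q)}

/-! ### The periodic word of a band -/

/-! Unroll the band, of length t, to a bi-infinite periodic word, and rescale the basis of M(b, μ,
1) so that every arrow moves a basis vector `vec k` to a neighbour with coefficient 1. The parameter
then survives only in the rule that `vec (k + t)` is `twist μ` times `vec k`. A homomorphism becomes
a matrix of coefficients indexed by pairs of integers. Coefficients are constant along matching
letters, and where the match around a nonzero coefficient stops, the source word leaves by a direct
letter and the target word by an inverse one. A band is primitive and differs from its reversed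
inverse, so around incongruent positions the match is shorter than a period. Mapping the matched
segment of the source onto that of the target is then a homomorphism whatever the parameters are.
Hence one off-diagonal coefficient, for one pair of parameters, yields for every pair a homomorphism
that takes a basis vector to one at an incongruent position (`Intertwines.exists_hom`).

Assertion 1 holds because M(b, λ, n) is an iterated extension of copies of M(b, λ, 1).

For assertion 2, endomorphisms without off-diagonal coefficients are scalars, so a non-brick has one
with such a coefficient, and there is a map g from M(b, λ, 1) to M(b, μ, 1) with a basis vector in
its image. Killing that vector cuts the cyclic word open, after which the parameter is invisible, so
the cokernel of g is a quotient of M(b, λ, 1) as well (`exists_surjective_quotient`). Thus M(b, μ,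
1) is an extension of two quotients of M(b, λ, 1).

For assertion 3, an off-diagonal coefficient between any two members would give an endomorphism of
the brick M(b, λ, 1) which, minus an eigenvalue, is neither zero nor invertible. Purely diagonal
maps between different members vanish since their twists differ. So the family is Hom-orthogonal,
and the modules without nonzero maps to any M(b, η, 1), η ≠ μ, form the class for μ. -/

theorem inv_inv (x : Letter Q) : x.inv.inv = x := by
  cases x; simp [Letter.inv]

theorem inv_ne (x : Letter Q) : x.inv ≠ x := fun h => by
  have := congrArg Letter.direct h
  simp [Letter.inv] at this

/-- The position of the word `b` that lies under an integer. -/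
def pos (h : 0 < b.length) (k : ℤ) : Fin b.length :=
  ⟨(k % b.length).toNat, by
    have h1 := Int.emod_lt_of_pos k (Int.natCast_pos.mpr h)
    omega⟩

theorem pos_val (h : 0 < b.length) (k : ℤ) : ((pos h k).val : ℤ) = k % b.length :=
  Int.toNat_of_nonneg (Int.emod_nonneg k (Int.natCast_pos.mpr h).ne')

theorem pos_eq_iff (h : 0 < b.length) (k l : ℤ) :
    pos h k = pos h l ↔ (b.length : ℤ) ∣ l - k := by
  rw [Fin.ext_iff, ← Int.natCast_inj, pos_val, pos_val]
  exact Int.modEq_iff_dvd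

theorem pos_natCast (h : 0 < b.length) (i : Fin b.length) : pos h (i.val : ℤ) = i := by
  rw [Fin.ext_iff, ← Int.natCast_inj, pos_val]
  exact Int.emod_eq_of_lt (by omega) (by have := i.isLt; omega)

theorem next_pos (h : 0 < b.length) (k : ℤ) : next (pos h k) = pos h (k + 1) := by
  rw [Fin.ext_iff, ← Int.natCast_inj, pos_val, next]
  push_cast
  rw [pos_val]
  simp

theorem next_injective : Function.Injective (next (b := b)) := by
  intro i j hij
  have h := i.pos
  rw [← pos_natCast h i, ← pos_natCast h j, next_pos, next_pos, pos_eq_iff] at hij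
  rw [← pos_natCast h i, ← pos_natCast h j, pos_eq_iff]
  simpa using hij

theorem get_next_ne (hb : IsBand R b) (i : Fin b.length) :
    b.get (next i) ≠ (b.get i).inv := by
  have h := (hb.isString_pow (i.val + 2)).1.infix (infix_wordPow b (length_pos hb) i.val 2)
  simp only [List.range'_succ, List.map_cons, List.isChain_cons_cons] at h
  have h' := h.1.2
  simp only [letterAt, Nat.mod_eq_of_lt i.isLt] at h'
  exact h'

/-- The letter of the bi-infinite periodic word that leads from `k` to `k + 1`. -/
def per (hb : IsBand R b) (k : ℤ) : Letter Q := b.get (pos (length_pos hb) k)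

/-- The letter that leads from `k` to `k + s`, for a direction `s`. -/
def out (hb : IsBand R b) (k : ℤ) (s : ℤˣ) : Letter Q :=
  if s = 1 then per hb k else (per hb (k - 1)).inv

variable (hb : IsBand R b)

theorem out_one (k : ℤ) : out hb k 1 = per hb k := if_pos rfl

theorem out_neg_one (k : ℤ) : out hb k (-1) = (per hb (k - 1)).inv := if_neg (by decide)

theorem out_add (k : ℤ) (s : ℤˣ) : out hb (k + s) (-s) = (out hb k s).inv := by
  rcases Int.units_eq_one_or s with rfl | rfl
  · rw [out_neg_one, out_one]
    simp
  · rw [neg_neg, out_neg_one, out_one, inv_inv]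
    simp [sub_eq_add_neg]

theorem per_add_one_ne (k : ℤ) : per hb (k + 1) ≠ (per hb k).inv := by
  rw [per, per, ← next_pos]
  exact get_next_ne hb _

theorem out_ne_neg (k : ℤ) (s : ℤˣ) : out hb k s ≠ out hb k (-s) := by
  have h : out hb k 1 ≠ out hb k (-1) := by
    rw [out_one, out_neg_one]
    simpa using per_add_one_ne hb (k - 1)
  rcases Int.units_eq_one_or s with rfl | rfl
  · exact h
  · rw [neg_neg]
    exact h.symm

theorem out_injective (k : ℤ) {s s' : ℤˣ} (h : out hb k s = out hb k s') : s = s' := by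
  rcases Int.units_eq_one_or s with rfl | rfl <;> rcases Int.units_eq_one_or s' with rfl | rfl
  · rfl
  · exact absurd h (out_ne_neg hb k 1)
  · exact absurd h.symm (out_ne_neg hb k 1)
  · rfl

theorem per_congr {k l : ℤ} (h : (b.length : ℤ) ∣ l - k) : per hb k = per hb l := by
  rw [per, per, (pos_eq_iff _ k l).mpr h]

theorem out_congr {k l : ℤ} (h : (b.length : ℤ) ∣ l - k) (s : ℤˣ) : out hb k s = out hb l s := by
  rcases Int.units_eq_one_or s with rfl | rfl
  · rw [out_one, out_one, per_congr hb h]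
  · rw [out_neg_one, out_neg_one, per_congr hb (l := l - 1) (by simpa using h)]

/-- A band has no nontrivial period. -/
theorem dvd_of_periodic (d : ℤ) (h : ∀ k, per hb k = per hb (k + d)) : (b.length : ℤ) ∣ d := by
  have ht := length_pos hb
  -- By Bézout the gcd g of the length and d is again a period. If it is a proper divisor of the
  -- length, then `b` is a proper power of its first g letters, which primitivity forbids.
  set g := Int.gcd b.length d with hg
  have hgpos : 0 < g := Int.gcd_pos_of_ne_zero_left _ (by omega)
  have hgt : g ∣ b.length := by
    exact_mod_cast (Int.gcd_dvd_left (b.length : ℤ) d)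
  have mul : ∀ (e : ℤ), (∀ k, per hb k = per hb (k + e)) → ∀ (m : ℕ) k,
      per hb k = per hb (k + m * e) := by
    intro e he m
    induction m with
    | zero => intro k; simp
    | succ m ih => intro k; rw [ih k, he]; congr 1; push_cast; ring
  have mulz : ∀ (e : ℤ), (∀ k, per hb k = per hb (k + e)) → ∀ (m : ℤ) k,
      per hb k = per hb (k + m * e) := by
    intro e he m k
    rcases Int.eq_nat_or_neg m with ⟨n, rfl | rfl⟩
    · exact mul e he n k
    · have := mul e he n (k + -n * e)
      rw [this]; congr 1; ring
  have hper : ∀ k, per hb k = per hb (k + g) := by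
    intro k
    rw [hg, Int.gcd_eq_gcd_ab, mulz d h (Int.gcdB b.length d) k]
    refine per_congr hb ⟨Int.gcdA b.length d, ?_⟩
    ring
  obtain ⟨m, hm⟩ := hgt
  by_contra hd
  have hm2 : 2 ≤ m := by
    rcases m with _ | _ | m
    · omega
    · exfalso
      apply hd
      rw [hm]
      simpa using Int.gcd_dvd_right (b.length : ℤ) d
    · omega
  refine hb.not_pow (b.take g) m hm2 ?_
  have hgle : g ≤ b.length := Nat.le_of_dvd ht ⟨m, hm⟩
  have hlen : (b.take g).length = g := by simp [hgle]
  have hlen0 : 0 < (b.take g).length := by omega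
  rw [wordPow_eq _ hlen0, hlen, mul_comm, ← hm]
  refine List.ext_getElem (by simp) fun i h1 h2 => ?_
  have e1 : i % g < b.length := lt_of_lt_of_le (Nat.mod_lt _ hgpos) hgle
  have key := mul g hper (i / g) ((i % g : ℕ) : ℤ)
  have e2 : ((i % g : ℕ) : ℤ) + ((i / g : ℕ) : ℤ) * (g : ℤ) = (i : ℤ) := by
    have := Nat.mod_add_div i g
    rw [mul_comm] at this
    exact_mod_cast this
  rw [e2] at key
  have p1 := pos_natCast ht (⟨i % g, e1⟩ : Fin b.length)
  have p2 := pos_natCast ht (⟨i, h2⟩ : Fin b.length)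
  simp only at p1 p2
  rw [per, per, p1, p2] at key
  simp [letterAt]
  have hmin : min g b.length = g := by omega
  simpa [hmin] using key

theorem exists_per_ne {i j : ℤ} (h : ¬ (b.length : ℤ) ∣ j - i) :
    ∃ k, per hb (i + k) ≠ per hb (j + k) := by
  by_contra! hc
  refine h (dvd_of_periodic hb (j - i) fun k => ?_)
  have := hc (k - i)
  rw [show i + (k - i) = k by ring] at this
  rw [this]
  congr 1
  ring

/-- The periodic word of a band does not coincide with its reversed inverse. -/
theorem exists_per_ne_inv (i j : ℤ) : ∃ k, per hb (i + k) ≠ (per hb (j - k - 1)).inv := by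
  by_contra! hc
  -- A coincidence would be a reflection of the word that inverts letters. Depending on parity it
  -- fixes a letter, which would be its own inverse, or swaps two adjacent letters, which would be
  -- mutually inverse.
  rcases Int.even_or_odd' (j - i - 1) with ⟨k, hk | hk⟩
  · have := hc k
    rw [show j - k - 1 = i + k by linarith] at this
    exact inv_ne _ this.symm
  · have := hc (k + 1)
    rw [show j - (k + 1) - 1 = i + k by linarith, show i + (k + 1) = i + k + 1 by ring] at this
    exact per_add_one_ne hb _ this

theorem exists_out_ne {i j : ℤ} (h : ¬ (b.length : ℤ) ∣ j - i) (s : ℤˣ) :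
    ∃ k : ℤ, out hb (i + k) 1 ≠ out hb (j + s * k) s := by
  rcases Int.units_eq_one_or s with rfl | rfl
  · obtain ⟨k, hk⟩ := exists_per_ne hb h
    exact ⟨k, by rw [out_one, out_one]; simpa using hk⟩
  · obtain ⟨k, hk⟩ := exists_per_ne_inv hb i j
    exact ⟨k, by rw [out_one, out_neg_one]; simpa [← sub_eq_add_neg] using hk⟩

/-! ### Coordinates on the band modules of rank one -/

/-- The factor by which the basis vectors change along one period of the word. -/
def twist (μ : Kˣ) : Kˣ := if (per hb (-1)).direct then μ else μ⁻¹

theorem twist_injective : Function.Injective (twist hb) := by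
  intro μ η h
  unfold twist at h
  split_ifs at h
  · exact h
  · exact inv_injective h

/-- The basis vectors of the band module, indexed by the bi-infinite periodic word. -/
def vec (μ : Kˣ) (k : ℤ) : Space K b 1 :=
  Pi.single (pos (length_pos hb) k) fun _ => ((twist hb μ ^ (k / b.length) : Kˣ) : K)

/-- The coordinate functionals of the band module, indexed by the bi-infinite periodic word. -/
def coord (μ : Kˣ) (k : ℤ) : Space K b 1 →ₗ[K] K :=
  ((twist hb μ ^ (-(k / b.length)) : Kˣ) : K) •
    ((LinearMap.proj 0 : (Fin 1 → K) →ₗ[K] K) ∘ₗ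
      (LinearMap.proj (pos (length_pos hb) k) : Space K b 1 →ₗ[K] (Fin 1 → K)))

theorem coord_apply (μ : Kˣ) (k : ℤ) (x : Space K b 1) :
    coord hb μ k x =
      ((twist hb μ ^ (-(k / b.length)) : Kˣ) : K) * x (pos (length_pos hb) k) 0 := rfl

theorem coord_ext (μ : Kˣ) {x y : Space K b 1} (h : ∀ k, coord hb μ k x = coord hb μ k y) :
    x = y := by
  funext i j
  have := h i.val
  rw [coord_apply, coord_apply, pos_natCast] at this
  rw [Subsingleton.elim j 0]
  exact mul_left_cancel₀ (Units.ne_zero _) this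

theorem coord_vec_add (μ : Kˣ) (k m : ℤ) :
    coord hb μ (k + b.length * m) (vec hb μ k) = ((twist hb μ ^ (-m) : Kˣ) : K) := by
  have ht : (b.length : ℤ) ≠ 0 := by have := length_pos hb; omega
  rw [coord_apply, vec, (pos_eq_iff (length_pos hb) (k + b.length * m) k).mpr ⟨-m, by ring⟩,
    Pi.single_eq_same, ← Units.val_mul, ← zpow_add, Int.add_mul_ediv_left _ _ ht]
  congr 2
  ring

theorem coord_vec_self (μ : Kˣ) (k : ℤ) : coord hb μ k (vec hb μ k) = 1 := by
  simpa using coord_vec_add hb μ k 0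

theorem coord_vec_of_not_dvd (μ : Kˣ) {j k : ℤ} (h : ¬ (b.length : ℤ) ∣ j - k) :
    coord hb μ j (vec hb μ k) = 0 := by
  rw [coord_apply, vec, Pi.single_eq_of_ne, Pi.zero_apply, mul_zero]
  rw [Ne, pos_eq_iff]
  intro hc
  exact h (by rw [← neg_sub]; exact hc.neg_right)

/-- The pairing depends only on the difference of the positions: it is a power of the twist when the
period divides it, and zero otherwise. -/
theorem coord_add_vec_add (μ : Kˣ) (j k m : ℤ) :
    coord hb μ (j + m) (vec hb μ (k + m)) = coord hb μ j (vec hb μ k) := by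
  by_cases h : (b.length : ℤ) ∣ j - k
  · obtain ⟨c, hc⟩ := h
    obtain rfl : j = k + b.length * c := by rw [← hc]; ring
    rw [show k + b.length * c + m = k + m + b.length * c by ring, coord_vec_add, coord_vec_add]
  · rw [coord_vec_of_not_dvd hb μ h, coord_vec_of_not_dvd hb μ (by simpa using h)]

theorem coord_add_length (μ : Kˣ) (k m : ℤ) (x : Space K b 1) :
    coord hb μ (k + b.length * m) x = ((twist hb μ ^ (-m) : Kˣ) : K) * coord hb μ k x := by
  have ht : (b.length : ℤ) ≠ 0 := by have := length_pos hb; omega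
  rw [coord_apply, coord_apply, (pos_eq_iff (length_pos hb) (k + b.length * m) k).mpr ⟨-m, by ring⟩,
    ← mul_assoc, ← Units.val_mul, ← zpow_add, Int.add_mul_ediv_left _ _ ht]
  congr 3
  ring

theorem vec_add_length (μ : Kˣ) (k m : ℤ) :
    vec hb μ (k + b.length * m) = ((twist hb μ ^ m : Kˣ) : K) • vec hb μ k := by
  have ht : (b.length : ℤ) ≠ 0 := by have := length_pos hb; omega
  rw [vec, vec, (pos_eq_iff (length_pos hb) (k + b.length * m) k).mpr ⟨-m, by ring⟩,
    Int.add_mul_ediv_left _ _ ht, zpow_add, ← Pi.single_smul]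
  congr 1
  funext _
  simp [mul_comm]

/-- A family of vectors `vec k`, for `k` in a window of one period, spans. -/
theorem lin_ext_vec (μ : Kˣ) (m : ℤ) {P : Type*} [AddCommGroup P] [Module K P]
    {f g : Space K b 1 →ₗ[K] P}
    (h : ∀ k, m ≤ k → k < m + b.length → f (vec hb μ k) = g (vec hb μ k)) : f = g := by
  have ht : 0 < (b.length : ℤ) := by have := length_pos hb; omega
  have h' : ∀ k, f (vec hb μ k) = g (vec hb μ k) := by
    intro k
    have e : k = (m + (k - m) % b.length) + b.length * ((k - m) / b.length) := by
      have := Int.emod_add_mul_ediv (k - m) b.length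
      linarith
    rw [e, vec_add_length, map_smul, map_smul,
      h _ (by have := Int.emod_nonneg (k - m) ht.ne'; omega)
        (by have := Int.emod_lt_of_pos (k - m) ht; omega)]
  refine LinearMap.pi_ext' fun i => LinearMap.ext fun v => ?_
  have hv : LinearMap.single K (fun _ : Fin b.length => Fin 1 → K) i v =
      v 0 • vec hb μ i.val := by
    rw [vec, pos_natCast, Int.ediv_eq_zero_of_lt (by omega) (by have := i.isLt; omega),
      ← Pi.single_smul]
    change (Pi.single i v : Space K b 1) = _
    congr 1
    funext j
    rw [Subsingleton.elim j 0]
    simp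
  rw [LinearMap.comp_apply, LinearMap.comp_apply, hv, map_smul, map_smul, h']

/-! ### The action of arrows and vertices in coordinates -/

open Classical in
-- Only the two letters adjacent to a position can contribute there. Since `next` is a bijection,
-- reading the value at `next j` covers all positions without naming a predecessor.
theorem arrowOp_apply_next (μ : K) (n : ℕ) (f : Quiver.Total Q) (x : Space K b n)
    (j : Fin b.length) :
    arrowOp b μ n f x (next j) =
      (if b.get j = ⟨f, true⟩ then letterMat b μ n j (x j) else 0) +
      (if b.get (next j) = ⟨f, false⟩ then letterMat b μ n (next j) (x (next (next j))) else 0) := by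
  have e1 : ∀ i, (if b.get i = ⟨f, true⟩ then
        (LinearMap.single K (fun _ => Fin n → K) (next i)) ∘ₗ letterMat b μ n i ∘ₗ
          (LinearMap.proj i) else 0 : Module.End K (Space K b n)) x (next j) =
      if i = j then (if b.get j = ⟨f, true⟩ then letterMat b μ n j (x j) else 0) else 0 := by
    intro i
    by_cases hij : i = j
    · subst hij
      rw [if_pos rfl]
      split_ifs
      · exact Pi.single_eq_same (M := fun _ : Fin b.length => Fin n → K) _ _
      · rfl
    · rw [if_neg hij]
      split_ifs
      · exact Pi.single_eq_of_ne (M := fun _ : Fin b.length => Fin n → K)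
          (fun h => hij (next_injective h).symm) _
      · rfl
  have e2 : ∀ i, (if b.get i = ⟨f, false⟩ then
        (LinearMap.single K (fun _ => Fin n → K) i) ∘ₗ letterMat b μ n i ∘ₗ
          (LinearMap.proj (next i)) else 0 : Module.End K (Space K b n)) x (next j) =
      if i = next j then (if b.get (next j) = ⟨f, false⟩ then
        letterMat b μ n (next j) (x (next (next j))) else 0) else 0 := by
    intro i
    by_cases hij : i = next j
    · subst hij
      rw [if_pos rfl]
      split_ifs
      · exact Pi.single_eq_same (M := fun _ : Fin b.length => Fin n → K) _ _
      · rfl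
    · rw [if_neg hij]
      split_ifs
      · exact Pi.single_eq_of_ne (M := fun _ : Fin b.length => Fin n → K) (Ne.symm hij) _
      · rfl
  rw [arrowOp, LinearMap.sum_apply, Finset.sum_apply]
  simp only [LinearMap.add_apply, Pi.add_apply, e1, e2, Finset.sum_add_distrib,
    Finset.sum_ite_eq', Finset.mem_univ, if_true]

/-- The normalisation absorbs the letter matrices. Away from the last letter, both the matrix and
the quotient of the position by the period are unaffected by a step; at the last letter the quotient
jumps by one, and the resulting power of the twist cancels the factor μ. -/
theorem twist_zpow_letterMat (μ : Kˣ) (k : ℤ) (v : Fin 1 → K) :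
    ((twist hb μ ^ (-((k + 1) / b.length)) : Kˣ) : K) *
        (if (per hb k).direct then letterMat b (μ : K) 1 (pos (length_pos hb) k) v 0 else v 0) =
      ((twist hb μ ^ (-(k / b.length)) : Kˣ) : K) *
        (if (per hb k).direct then v 0 else letterMat b (μ : K) 1 (pos (length_pos hb) k) v 0) := by
  have ht : 0 < (b.length : ℤ) := by have := length_pos hb; omega
  have hv := pos_val (length_pos hb) k
  have hdiv := Int.emod_add_mul_ediv k b.length
  by_cases h : (pos (length_pos hb) k).val + 1 = b.length
  · have hp : per hb k = per hb (-1) := by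
      refine per_congr hb ⟨-(k / b.length + 1), ?_⟩
      have : k % (b.length : ℤ) + 1 = b.length := by rw [← hv]; exact_mod_cast h
      linarith
    have hq : (k + 1) / (b.length : ℤ) = k / b.length + 1 := by
      have : k + 1 = b.length * (k / b.length + 1) := by
        have : k % (b.length : ℤ) + 1 = b.length := by rw [← hv]; exact_mod_cast h
        linarith
      rw [this, Int.mul_ediv_cancel_left _ ht.ne']
    have hL : letterMat b (μ : K) 1 (pos (length_pos hb) k) v 0 = μ * v 0 := by
      rw [letterMat, if_pos h]
      simp [Matrix.toLin'_apply, Matrix.mulVec, dotProduct, jordanBlock]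
    rw [hL, hq, hp, neg_add, zpow_add, twist]
    split_ifs <;> simp [mul_assoc]
  · have hL : letterMat b (μ : K) 1 (pos (length_pos hb) k) v = v := by
      rw [letterMat, if_neg h]; rfl
    have hq : (k + 1) / (b.length : ℤ) = k / b.length := by
      have h1 := (pos (length_pos hb) k).isLt
      have h2 : k % (b.length : ℤ) + 1 < b.length := by rw [← hv]; exact_mod_cast (by omega)
      rw [show k + 1 = (k % (b.length : ℤ) + 1) + b.length * (k / b.length) by linarith,
        Int.add_mul_ediv_left _ _ ht.ne', Int.ediv_eq_zero_of_lt (by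
          have := Int.emod_nonneg k ht.ne'; omega) h2, zero_add]
    rw [hL, hq]

open Classical in
-- An arrow leading from a neighbour into `k` is seen from `k` as an inverse letter leading out;
-- after normalisation it carries coefficient 1, whatever the parameter.
theorem coord_arrowOp (μ : Kˣ) (k : ℤ) (f : Quiver.Total Q) (x : Space K b 1) :
    coord hb μ k (arrowOp b (μ : K) 1 f x) =
      ∑ s : ℤˣ, if out hb k s = ⟨f, false⟩ then coord hb μ (k + s) x else 0 := by
  have hu : (Finset.univ : Finset ℤˣ) = {1, -1} := rfl
  rw [hu, Finset.sum_pair (by decide), out_one, out_neg_one, add_comm]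
  have hk : pos (length_pos hb) k = next (pos (length_pos hb) (k - 1)) := by
    rw [next_pos, sub_add_cancel]
  have hinv : (per hb (k - 1)).inv = ⟨f, false⟩ ↔ b.get (pos (length_pos hb) (k - 1)) = ⟨f, true⟩ := by
    rw [per]
    constructor <;> intro h
    · rw [← inv_inv (b.get _), h]; rfl
    · rw [h]; rfl
  rw [coord_apply, hk, arrowOp_apply_next, ← hk, next_pos, Pi.add_apply, mul_add]
  congr 1
  · by_cases h : (per hb (k - 1)).inv = ⟨f, false⟩
    · rw [if_pos h, if_pos (hinv.mp h), coord_apply]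
      have := twist_zpow_letterMat hb μ (k - 1) (x (pos (length_pos hb) (k - 1)))
      have hd : (per hb (k - 1)).direct = true := by rw [per, hinv.mp h]
      rw [hd, if_pos rfl, if_pos rfl, sub_add_cancel] at this
      rw [this]
      simp [sub_eq_add_neg]
    · rw [if_neg h, if_neg (fun h' => h (hinv.mpr h'))]
      simp
  · by_cases h : per hb k = ⟨f, false⟩
    · rw [if_pos h, if_pos (by exact h), coord_apply]
      have := twist_zpow_letterMat hb μ k (x (pos (length_pos hb) (k + 1)))
      have hd : (per hb k).direct = false := by rw [h]
      simp only [hd, Bool.false_eq_true, if_false] at this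
      rw [← this]
      simp
    · rw [if_neg h, if_neg (by exact h)]
      simp

open Classical in
theorem arrowOp_vec (μ : Kˣ) (k : ℤ) (f : Quiver.Total Q) :
    arrowOp b (μ : K) 1 f (vec hb μ k) =
      ∑ s : ℤˣ, if out hb k s = ⟨f, true⟩ then vec hb μ (k + s) else 0 := by
  refine coord_ext hb μ fun j => ?_
  -- The step from `k` in direction `s` is undone by a step in direction `-s`, so the two sums
  -- correspond after reversing directions.
  rw [coord_arrowOp, map_sum, ← Equiv.sum_comp (Equiv.neg ℤˣ)]
  refine Finset.sum_congr rfl fun s _ => ?_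
  rw [apply_ite (coord hb μ j), map_zero, Equiv.neg_apply]
  have e : coord hb μ (j + ((-s : ℤˣ) : ℤ)) (vec hb μ k) = coord hb μ j (vec hb μ (k + s)) := by
    rw [← coord_add_vec_add hb μ _ k s]
    simp
  rw [e]
  by_cases h : (b.length : ℤ) ∣ j - (k + s)
  · have : out hb j (-s) = (out hb k s).inv := by
      rw [← out_add, out_congr hb (by rw [← neg_sub]; exact h.neg_right) (-s)]
    rw [this]
    refine if_congr ⟨fun h' => ?_, fun h' => ?_⟩ rfl rfl
    · rw [← inv_inv (out hb k s), h']; rfl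
    · rw [h']; rfl
  · rw [coord_vec_of_not_dvd hb μ h, ite_self, ite_self]

open Classical in
theorem coord_vertexOp (μ : Kˣ) (k : ℤ) (a : Q) (x : Space K b 1) :
    coord hb μ k (vertexOp b 1 a x) = if (per hb k).src = a then coord hb μ k x else 0 := by
  rw [coord_apply, vertexOp_apply]
  change _ * (if (per hb k).src = a then _ else (0 : Fin 1 → K)) 0 = _
  split_ifs
  · rfl
  · simp

open Classical in
theorem vertexOp_vec (μ : Kˣ) (k : ℤ) (a : Q) :
    vertexOp b 1 a (vec hb μ k) = if (per hb k).src = a then vec hb μ k else 0 := by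
  refine coord_ext hb μ fun j => ?_
  rw [coord_vertexOp, apply_ite (coord hb μ j), map_zero]
  by_cases h : (b.length : ℤ) ∣ j - k
  · rw [per_congr hb h]
  · rw [coord_vec_of_not_dvd hb μ h, ite_self, ite_self]

end

end Band

namespace Band

noncomputable section

variable {K Q : Type u} [Field K] [Quiver.{u} Q] {R : Set (PathAlgebra K Q)}
  {b : List (Letter Q)}

/-! ### Maps between band modules in coordinates -/

/-- A linear map between the spaces of two band modules that commutes with the action of the
vertices and of the arrows. -/
structure Intertwines (b : List (Letter Q)) (μ η : K) {n m : ℕ}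
    (φ : Space K b n →ₗ[K] Space K b m) : Prop where
  vertex : ∀ a x, φ (vertexOp b n a x) = vertexOp b m a (φ x)
  arrow : ∀ f x, φ (arrowOp b μ n f x) = arrowOp b η m f (φ x)

variable (hb : IsBand R b)

theorem arrowOp_vec_of (μ : Kˣ) {k : ℤ} {f : Quiver.Total Q} {s : ℤˣ}
    (h : out hb k s = ⟨f, true⟩) :
    arrowOp b (μ : K) 1 f (vec hb μ k) = vec hb μ (k + s) := by
  classical
  rw [arrowOp_vec, Finset.sum_eq_single s, if_pos h]
  · intro s' _ hs'
    exact if_neg fun h' => hs' (out_injective hb k (h'.trans h.symm))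
  · exact fun h' => absurd (Finset.mem_univ s) h'

theorem arrowOp_vec_eq_zero (μ : Kˣ) {k : ℤ} {f : Quiver.Total Q}
    (h : ∀ s, out hb k s ≠ ⟨f, true⟩) : arrowOp b (μ : K) 1 f (vec hb μ k) = 0 := by
  classical
  rw [arrowOp_vec]
  exact Finset.sum_eq_zero fun s _ => if_neg (h s)

theorem coord_arrowOp_of (μ : Kˣ) {k : ℤ} {f : Quiver.Total Q} {s : ℤˣ}
    (h : out hb k s = ⟨f, false⟩) (x : Space K b 1) :
    coord hb μ k (arrowOp b (μ : K) 1 f x) = coord hb μ (k + s) x := by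
  classical
  rw [coord_arrowOp, Finset.sum_eq_single s, if_pos h]
  · intro s' _ hs'
    exact if_neg fun h' => hs' (out_injective hb k (h'.trans h.symm))
  · exact fun h' => absurd (Finset.mem_univ s) h'

theorem coord_arrowOp_eq_zero (μ : Kˣ) {k : ℤ} {f : Quiver.Total Q}
    (h : ∀ s, out hb k s ≠ ⟨f, false⟩) (x : Space K b 1) :
    coord hb μ k (arrowOp b (μ : K) 1 f x) = 0 := by
  classical
  rw [coord_arrowOp]
  exact Finset.sum_eq_zero fun s _ => if_neg (h s)

theorem out_add_of_eq {k : ℤ} {s : ℤˣ} {f : Quiver.Total Q} {d : Bool}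
    (h : out hb k s = ⟨f, d⟩) : out hb (k + s) (-s) = ⟨f, !d⟩ := by
  rw [out_add, h]; rfl

/-! ### Coefficients of homomorphisms -/

section

variable {hb} {μ η : Kˣ} {φ : Space K b 1 →ₗ[K] Space K b 1}

/-- Along letters that match, the coefficients of a homomorphism are constant. -/
theorem Intertwines.coeff_add (hφ : Intertwines b (μ : K) η φ) {i j : ℤ} {s s' : ℤˣ}
    (h : out hb i s = out hb j s') :
    coord hb η (j + s') (φ (vec hb μ (i + s))) = coord hb η j (φ (vec hb μ i)) := by
  have direct : ∀ {i j : ℤ} {s s' : ℤˣ} {f : Quiver.Total Q}, out hb i s = ⟨f, true⟩ →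
      out hb j s' = ⟨f, true⟩ →
      coord hb η (j + s') (φ (vec hb μ (i + s))) = coord hb η j (φ (vec hb μ i)) := by
    intro i j s s' f h1 h2
    rw [← arrowOp_vec_of hb μ h1, hφ.arrow, coord_arrowOp_of hb η (out_add_of_eq hb h2)]
    simp
  obtain ⟨⟨f, d⟩, hx⟩ : ∃ y, out hb i s = y := ⟨_, rfl⟩
  cases d
  · have h1 := out_add_of_eq hb hx
    have h2 := out_add_of_eq hb (h.symm.trans hx)
    have := direct h1 h2
    simpa using this.symm
  · exact direct hx (h.symm.trans hx)

/-- The arrow of a direct letter leaving `j` carries the nonzero coefficient on to the next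
position, so that arrow cannot kill `vec i` in the source. -/
theorem Intertwines.exists_out_eq_of_direct (hφ : Intertwines b (μ : K) η φ) {i j : ℤ}
    (h0 : coord hb η j (φ (vec hb μ i)) ≠ 0) {s : ℤˣ} (hs : (out hb j s).direct = true) :
    ∃ s', out hb i s' = out hb j s := by
  by_contra! hc
  obtain ⟨⟨f, d⟩, hx⟩ : ∃ y, out hb j s = y := ⟨_, rfl⟩
  rw [hx] at hs hc
  obtain rfl : d = true := hs
  apply h0
  have := coord_arrowOp_of hb η (out_add_of_eq hb hx) (φ (vec hb μ i))
  rw [← hφ.arrow, arrowOp_vec_eq_zero hb μ hc] at this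
  simpa using this.symm

/-- Dually, an inverse letter leaving `i` exhibits `vec i` as the image of its neighbour under an
arrow. The image under φ lies in the range of the same arrow, which must therefore reach `j`. -/
theorem Intertwines.exists_out_eq_of_inverse (hφ : Intertwines b (μ : K) η φ) {i j : ℤ}
    (h0 : coord hb η j (φ (vec hb μ i)) ≠ 0) {s : ℤˣ} (hs : (out hb i s).direct = false) :
    ∃ s', out hb j s' = out hb i s := by
  by_contra! hc
  obtain ⟨⟨f, d⟩, hx⟩ : ∃ y, out hb i s = y := ⟨_, rfl⟩
  rw [hx] at hs hc
  obtain rfl : d = false := hs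
  apply h0
  have := arrowOp_vec_of hb μ (out_add_of_eq hb hx)
  simp only [Units.val_neg, add_neg_cancel_right] at this
  rw [← this, hφ.arrow, coord_arrowOp_eq_zero hb η hc]

theorem Intertwines.src_eq (hφ : Intertwines b (μ : K) η φ) {i j : ℤ}
    (h0 : coord hb η j (φ (vec hb μ i)) ≠ 0) : (per hb i).src = (per hb j).src := by
  classical
  have h := congrArg (coord hb η j) (hφ.vertex (per hb i).src (vec hb μ i))
  rw [vertexOp_vec, if_pos rfl, coord_vertexOp] at h
  by_contra hc
  rw [if_neg (Ne.symm hc)] at h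
  exact h0 h

/-- The diagonal coefficients of a homomorphism. -/
theorem Intertwines.coeff_diag (hφ : Intertwines b (μ : K) η φ) (i : ℤ) :
    coord hb η i (φ (vec hb μ i)) = coord hb η 0 (φ (vec hb μ 0)) := by
  induction i with
  | zero => rfl
  | succ i ih => rw [← ih]; exact hφ.coeff_add (s := 1) (s' := 1) rfl
  | pred i ih =>
    rw [← ih]
    simpa [sub_eq_add_neg] using hφ.coeff_add (hb := hb) (i := -i) (s := -1) (s' := -1) rfl

/-- The diagonal coefficient is unchanged after one full period, while the basis vector picks up the
twist of μ and the coordinate the inverse twist of η. -/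
theorem Intertwines.twist_smul (hφ : Intertwines b (μ : K) η φ) :
    (twist hb μ : K) * coord hb η 0 (φ (vec hb μ 0)) =
      (twist hb η : K) * coord hb η 0 (φ (vec hb μ 0)) := by
  have h := hφ.coeff_diag (hb := hb) (0 + b.length * 1)
  rw [coord_add_length, vec_add_length, map_smul, map_smul, smul_eq_mul, zpow_one, zpow_neg,
    zpow_one, ← mul_assoc] at h
  have h2 := congrArg ((twist hb η : K) * ·) h
  simp only [← mul_assoc, Units.mul_inv, one_mul] at h2
  exact h2

/-- A homomorphism without off-diagonal coefficients is a scalar. -/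
theorem Intertwines.eq_smul (hφ : Intertwines b (μ : K) μ φ)
    (h : ∀ i j : ℤ, ¬ (b.length : ℤ) ∣ j - i → coord hb μ j (φ (vec hb μ i)) = 0) :
    φ = coord hb μ 0 (φ (vec hb μ 0)) • LinearMap.id := by
  refine lin_ext_vec hb μ 0 fun i _ _ => coord_ext hb μ fun j => ?_
  rw [LinearMap.smul_apply, map_smul, LinearMap.id_apply, smul_eq_mul]
  by_cases hd : (b.length : ℤ) ∣ j - i
  · obtain ⟨c, hc⟩ := hd
    obtain rfl : j = i + b.length * c := by rw [← hc]; ring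
    rw [coord_add_length, hφ.coeff_diag, coord_vec_add, mul_comm]
  · rw [h i j hd, coord_vec_of_not_dvd hb μ hd, mul_zero]

/-- A homomorphism between different members of the family without off-diagonal coefficients
is zero. -/
theorem Intertwines.eq_zero (hφ : Intertwines b (μ : K) η φ) (hμη : μ ≠ η)
    (h : ∀ i j : ℤ, ¬ (b.length : ℤ) ∣ j - i → coord hb η j (φ (vec hb μ i)) = 0) : φ = 0 := by
  have h0 : coord hb η 0 (φ (vec hb μ 0)) = 0 := by
    by_contra hc
    exact hμη (twist_injective hb (Units.ext (mul_right_cancel₀ hc hφ.twist_smul)))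
  refine lin_ext_vec hb μ 0 fun i _ _ => coord_ext hb η fun j => ?_
  rw [LinearMap.zero_apply, map_zero]
  by_cases hd : (b.length : ℤ) ∣ j - i
  · obtain ⟨c, hc⟩ := hd
    obtain rfl : j = i + b.length * c := by rw [← hc]; ring
    rw [coord_add_length, hφ.coeff_diag, h0, mul_zero]
  · exact h i j hd

end

/-! ### Window maps -/

/-- The linear map that sends the basis vectors at the positions `i, …, i + L` to those at the
positions `j, j + s, …, j + s * L`. -/
def window (μ η : Kˣ) (i j : ℤ) (s : ℤˣ) (L : ℕ) : Space K b 1 →ₗ[K] Space K b 1 :=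
  ∑ k ∈ Finset.range (L + 1), (coord hb μ (i + k)).smulRight (vec hb η (j + s * k))

theorem window_apply (μ η : Kˣ) (i j : ℤ) (s : ℤˣ) (L : ℕ) (x : Space K b 1) :
    window hb μ η i j s L x =
      ∑ k ∈ Finset.range (L + 1), coord hb μ (i + k) x • vec hb η (j + s * k) := by
  simp [window, LinearMap.sum_apply]

/-- The window is at most one period long, so its positions in the source are pairwise incongruent
and only one summand survives. -/
theorem window_vec (μ η : Kˣ) (i j : ℤ) (s : ℤˣ) (L : ℕ) (hL : L < b.length) {p : ℕ}
    (hp : p ≤ L) : window hb μ η i j s L (vec hb μ (i + p)) = vec hb η (j + s * p) := by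
  rw [window_apply, Finset.sum_eq_single p, coord_vec_self, one_smul]
  · intro k hk hkp
    rw [coord_vec_of_not_dvd, zero_smul]
    rw [Finset.mem_range] at hk
    intro hd
    have := Int.eq_zero_of_abs_lt_dvd hd (by rw [abs_lt]; constructor <;> omega)
    omega
  · intro h
    exact absurd (Finset.mem_range.mpr (by omega)) h

theorem window_vertexOp (μ η : Kˣ) (i j : ℤ) (s : ℤˣ) (L : ℕ)
    (h : ∀ k : ℕ, k ≤ L → (per hb (i + k)).src = (per hb (j + s * k)).src) (a : Q)
    (x : Space K b 1) :
    window hb μ η i j s L (vertexOp b 1 a x) = vertexOp b 1 a (window hb μ η i j s L x) := by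
  classical
  rw [window_apply, window_apply, map_sum]
  refine Finset.sum_congr rfl fun k hk => ?_
  rw [map_smul, vertexOp_vec, coord_vertexOp, h k (by rw [Finset.mem_range] at hk; omega)]
  split_ifs <;> simp

open Classical in
/-- A window map commutes with the arrows up to terms at the boundary of the window. -/
theorem window_arrowOp (μ η : Kˣ) (i j : ℤ) (s : ℤˣ) (L : ℕ)
    (h : ∀ k : ℕ, k < L → out hb (i + k) 1 = out hb (j + s * k) s) (f : Quiver.Total Q)
    (x : Space K b 1) :
    window hb μ η i j s L (arrowOp b (μ : K) 1 f x) =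
      arrowOp b (η : K) 1 f (window hb μ η i j s L x) +
      (if out hb i (-1) = ⟨f, false⟩ then coord hb μ (i - 1) x • vec hb η j else 0) +
      (if out hb (i + L) 1 = ⟨f, false⟩ then
        coord hb μ (i + L + 1) x • vec hb η (j + s * L) else 0) -
      (if out hb j (-s) = ⟨f, true⟩ then coord hb μ i x • vec hb η (j - s) else 0) -
      (if out hb (j + s * L) s = ⟨f, true⟩ then
        coord hb μ (i + L) x • vec hb η (j + s * L + s) else 0) := by
  have hu : ∀ g : ℤˣ → Space K b 1, ∑ r : ℤˣ, g r = g s + g (-s) := by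
    intro g
    have : (Finset.univ : Finset ℤˣ) = {s, -s} := by
      rcases Int.units_eq_one_or s with rfl | rfl <;> decide
    rw [this, Finset.sum_pair]
    rcases Int.units_eq_one_or s with rfl | rfl <;> decide
  have hu' : ∀ g : ℤˣ → K, ∑ r : ℤˣ, g r = g 1 + g (-1) := by
    intro g
    rw [show (Finset.univ : Finset ℤˣ) = {1, -1} from rfl, Finset.sum_pair (by decide)]
  have e1 : window hb μ η i j s L (arrowOp b (μ : K) 1 f x) =
      ∑ k ∈ Finset.range (L + 1), (if out hb (i + k) 1 = ⟨f, false⟩ then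
        coord hb μ (i + k + 1) x • vec hb η (j + s * k) else 0) +
      ∑ k ∈ Finset.range (L + 1), (if out hb (i + k) (-1) = ⟨f, false⟩ then
        coord hb μ (i + k - 1) x • vec hb η (j + s * k) else 0) := by
    rw [window_apply, ← Finset.sum_add_distrib]
    refine Finset.sum_congr rfl fun k _ => ?_
    rw [coord_arrowOp, hu', add_smul]
    simp only [ite_smul, zero_smul]
    simp [sub_eq_add_neg]
  have e2 : arrowOp b (η : K) 1 f (window hb μ η i j s L x) =
      ∑ k ∈ Finset.range (L + 1), (if out hb (j + s * k) s = ⟨f, true⟩ then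
        coord hb μ (i + k) x • vec hb η (j + s * k + s) else 0) +
      ∑ k ∈ Finset.range (L + 1), (if out hb (j + s * k) (-s) = ⟨f, true⟩ then
        coord hb μ (i + k) x • vec hb η (j + s * k - s) else 0) := by
    rw [window_apply, map_sum, ← Finset.sum_add_distrib]
    refine Finset.sum_congr rfl fun k _ => ?_
    rw [map_smul, arrowOp_vec, hu, smul_add, smul_ite, smul_ite, smul_zero]
    simp [sub_eq_add_neg]
  have flip : ∀ (k : ℤ) (r : ℤˣ) (d : Bool),
      out hb (k + r) (-r) = ⟨f, d⟩ ↔ out hb k r = ⟨f, !d⟩ := by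
    intro k r d
    rw [out_add]
    constructor <;> intro h'
    · rw [← inv_inv (out hb k r), h']; rfl
    · rw [h']; cases d <;> rfl
  -- The last term of each forward sum and the first term of each backward sum cross the boundary.
  -- In the interior, the forward sum on one side equals the backward sum on the other, because an
  -- inverse letter read forward is a direct letter read backward.
  rw [e1, e2, Finset.sum_range_succ, Finset.sum_range_succ' _ L, Finset.sum_range_succ,
    Finset.sum_range_succ' _ L]
  have t1 : ∑ k ∈ Finset.range L, (if out hb (i + k) 1 = ⟨f, false⟩ then
        coord hb μ (i + k + 1) x • vec hb η (j + s * k) else 0) =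
      ∑ k ∈ Finset.range L, (if out hb (j + s * (k + 1 : ℕ)) (-s) = ⟨f, true⟩ then
        coord hb μ (i + (k + 1 : ℕ)) x • vec hb η (j + s * (k + 1 : ℕ) - s) else 0) := by
    refine Finset.sum_congr rfl fun k hk => ?_
    have hv : j + (s : ℤ) * ((k + 1 : ℕ) : ℤ) = j + s * k + s := by push_cast; ring
    rw [hv]
    refine if_congr ?_ ?_ rfl
    · rw [flip, h k (Finset.mem_range.mp hk)]; rfl
    · push_cast
      rw [add_sub_cancel_right, add_assoc]
  have t2 : ∑ k ∈ Finset.range L, (if out hb (i + (k + 1 : ℕ)) (-1) = ⟨f, false⟩ then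
        coord hb μ (i + (k + 1 : ℕ) - 1) x • vec hb η (j + s * (k + 1 : ℕ)) else 0) =
      ∑ k ∈ Finset.range L, (if out hb (j + s * k) s = ⟨f, true⟩ then
        coord hb μ (i + k) x • vec hb η (j + s * k + s) else 0) := by
    refine Finset.sum_congr rfl fun k hk => ?_
    have hv : j + (s : ℤ) * ((k + 1 : ℕ) : ℤ) = j + s * k + s := by push_cast; ring
    have hi : i + ((k + 1 : ℕ) : ℤ) = i + k + ((1 : ℤˣ) : ℤ) := by push_cast; ring
    rw [hv, hi]
    refine if_congr ?_ ?_ rfl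
    · rw [flip, h k (Finset.mem_range.mp hk)]; rfl
    · push_cast
      rw [add_sub_cancel_right]
  rw [t1, t2]
  simp only [Nat.cast_zero, mul_zero, add_zero]
  abel

/-- The window map of one full period is surjective. -/
theorem window_surjective (μ η : Kˣ) (i j : ℤ) :
    Function.Surjective (window hb μ η i j 1 (b.length - 1)) := by
  have ht := length_pos hb
  have h : (window hb μ η i j 1 (b.length - 1)) ∘ₗ (window hb η μ j i 1 (b.length - 1)) =
      LinearMap.id := by
    refine lin_ext_vec hb η j fun k h1 h2 => ?_
    obtain ⟨p, rfl⟩ : ∃ p : ℕ, k = j + p := ⟨(k - j).toNat, by omega⟩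
    have e := window_vec hb η μ j i 1 (b.length - 1) (by omega) (p := p) (by omega)
    have e' := window_vec hb μ η i j 1 (b.length - 1) (by omega) (p := p) (by omega)
    simp only [Units.val_one, one_mul] at e e'
    rw [LinearMap.comp_apply, e, e', LinearMap.id_apply]
  intro y
  exact ⟨_, LinearMap.congr_fun h y⟩

/-- An off-diagonal coefficient of a homomorphism gives rise to a homomorphism between any two
members of the family that maps a basis vector to a basis vector at a different position. -/
theorem Intertwines.exists_hom {μ η : Kˣ} {φ : Space K b 1 →ₗ[K] Space K b 1}
    (hφ : Intertwines b (μ : K) η φ) {i₀ j₀ : ℤ} (hd : ¬ (b.length : ℤ) ∣ j₀ - i₀)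
    (h0 : coord hb η j₀ (φ (vec hb μ i₀)) ≠ 0) (lam ν : Kˣ) :
    ∃ ψ : Space K b 1 →ₗ[K] Space K b 1, Intertwines b (lam : K) ν ψ ∧
      ψ (vec hb lam i₀) = vec hb ν j₀ := by
  classical
  -- Choice of the relative orientation of the two words: parallel if some letter matches that way
  -- at the starting pair, antiparallel otherwise. This rules out crossed matches below, even when
  -- the matched segment is a single position.
  obtain ⟨s, hs⟩ : ∃ s : ℤˣ, (s = 1 ∧ ∃ r, out hb i₀ r = out hb j₀ r) ∨
      (s = -1 ∧ ∀ r, out hb i₀ r ≠ out hb j₀ r) := by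
    by_cases h : ∃ r, out hb i₀ r = out hb j₀ r
    · exact ⟨1, Or.inl ⟨rfl, h⟩⟩
    · exact ⟨-1, Or.inr ⟨rfl, not_exists.mp h⟩⟩
  let M : ℤ → Prop := fun k => out hb (i₀ + k) 1 = out hb (j₀ + s * k) s
  have Mper : ∀ k m : ℤ, M (k + b.length * m) ↔ M k := by
    intro k m
    have e1 := out_congr hb (k := i₀ + (k + b.length * m)) (l := i₀ + k) ⟨-m, by ring⟩ 1
    have e2 := out_congr hb (k := j₀ + s * (k + b.length * m)) (l := j₀ + s * k)
      ⟨-s * m, by ring⟩ s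
    simp only [M, e1, e2]
  -- `M k` concerns the edge from `k` to `k + 1`; here the edge ending at `k` is read from its right
  -- end.
  have Mflip : ∀ k : ℤ, M (k - 1) ↔ out hb (i₀ + k) (-1) = out hb (j₀ + s * k) (-s) := by
    intro k
    have e1 := out_add hb (i₀ + (k - 1)) 1
    have e2 := out_add hb (j₀ + s * (k - 1)) s
    rw [show i₀ + (k - 1) + ((1 : ℤˣ) : ℤ) = i₀ + k by push_cast; ring] at e1
    rw [show j₀ + (s : ℤ) * (k - 1) + (s : ℤ) = j₀ + s * k by ring] at e2
    rw [e1, e2]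
    constructor
    · intro h; rw [show out hb (i₀ + (k - 1)) 1 = _ from h]
    · intro h
      have := congrArg Letter.inv h
      rwa [inv_inv, inv_inv] at this
  have ht : (0 : ℤ) < b.length := by have := length_pos hb; omega
  obtain ⟨k₀, hk₀⟩ : ∃ k, ¬ M k := exists_out_ne hb hd s
  -- By periodicity the mismatch recurs on both sides of the start. The maximal match thus consists
  -- of the edges from `-p` up to `q`, bounded by the bad edges `q` and `-p - 1`.
  have hq : ∃ n : ℕ, ¬ M n := by
    refine ⟨(k₀ % b.length).toNat, fun h => hk₀ ?_⟩
    rw [Int.toNat_of_nonneg (Int.emod_nonneg _ ht.ne')] at h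
    rw [← Int.emod_add_mul_ediv k₀ b.length]
    exact (Mper _ _).mpr h
  have hp : ∃ n : ℕ, ¬ M (-n - 1) := by
    refine ⟨((-k₀ - 1) % b.length).toNat, fun h => hk₀ ?_⟩
    rw [Int.toNat_of_nonneg (Int.emod_nonneg _ ht.ne')] at h
    have := Int.emod_add_mul_ediv (-k₀ - 1) b.length
    rw [show k₀ = (-((-k₀ - 1) % b.length) - 1) + b.length * (-((-k₀ - 1) / b.length)) by
      linarith]
    exact (Mper _ _).mpr h
  set q := Nat.find hq
  set p := Nat.find hp
  have hMq : ¬ M q := Nat.find_spec hq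
  have hMp : ¬ M (-p - 1) := Nat.find_spec hp
  have hM : ∀ k : ℤ, -p ≤ k → k < q → M k := by
    intro k h1 h2
    by_cases hk : 0 ≤ k
    · have := Nat.find_min hq (m := k.toNat) (by omega)
      rw [not_not, Int.toNat_of_nonneg hk] at this
      exact this
    · have := Nat.find_min hp (m := (-k - 1).toNat) (by omega)
      rw [not_not, Int.toNat_of_nonneg (by omega)] at this
      convert this using 1
      ring
  -- A match of at least one period would contain a translate of the bad edge `k₀`.
  have hpq : p + q < b.length := by
    by_contra hc
    apply hk₀
    have h1 := Int.emod_nonneg (k₀ + p) ht.ne'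
    have h2 := Int.emod_lt_of_pos (k₀ + p) ht
    have h3 := Int.emod_add_mul_ediv (k₀ + p) b.length
    rw [show k₀ = ((k₀ + p) % b.length - p) + b.length * ((k₀ + p) / b.length) by linarith]
    exact (Mper _ _).mpr (hM _ (by omega) (by omega))
  have hstep : ∀ k : ℤ, M k → coord hb η (j₀ + s * (k + 1)) (φ (vec hb μ (i₀ + (k + 1)))) =
      coord hb η (j₀ + s * k) (φ (vec hb μ (i₀ + k))) := by
    intro k hk
    rw [← hφ.coeff_add (hb := hb) hk, show i₀ + (k + 1) = i₀ + k + ((1 : ℤˣ) : ℤ) by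
      push_cast; ring, show j₀ + (s : ℤ) * (k + 1) = j₀ + s * k + s by ring]
  have hF : ∀ k : ℤ, -p ≤ k → k ≤ q →
      coord hb η (j₀ + s * k) (φ (vec hb μ (i₀ + k))) ≠ 0 := by
    have up : ∀ k : ℕ, k ≤ q → coord hb η (j₀ + s * k) (φ (vec hb μ (i₀ + k))) ≠ 0 := by
      intro k
      induction k with
      | zero => intro _; simpa using h0
      | succ k ih =>
        intro hk
        push_cast
        rw [hstep k (hM _ (by omega) (by omega))]
        exact ih (by omega)
    have down : ∀ k : ℕ, k ≤ p →
        coord hb η (j₀ + s * (-k : ℤ)) (φ (vec hb μ (i₀ + (-k : ℤ)))) ≠ 0 := by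
      intro k
      induction k with
      | zero => intro _; simpa using h0
      | succ k ih =>
        intro hk
        have := hstep (-(k + 1 : ℕ)) (hM _ (by omega) (by omega))
        rw [← this, show (-((k + 1 : ℕ) : ℤ)) + 1 = -k by push_cast; ring]
        exact ih (by omega)
    intro k h1 h2
    rcases Int.eq_nat_or_neg k with ⟨n, rfl | rfl⟩
    · exact up n (by omega)
    · exact down n (by omega)
  -- A letter matched against the wrong direction, next to a correctly matched edge, would make the
  -- two letters leaving one position equal. A position without a correctly matched edge must be the
  -- start, with `p = q = 0`, and there the choice of `s` decides.
  have hcross : ∀ k : ℤ, -p ≤ k → k ≤ q → ∀ r : ℤˣ,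
      out hb (i₀ + k) r ≠ out hb (j₀ + s * k) (-(s * r)) := by
    intro k h1 h2 r hr
    have c1 : ¬ M k := by
      intro hk
      have hk' : out hb (i₀ + k) 1 = out hb (j₀ + s * k) s := hk
      rcases Int.units_eq_one_or r with rfl | rfl
      · rw [hk', mul_one] at hr
        exact out_ne_neg hb _ _ hr
      · rw [mul_neg, neg_neg, mul_one, ← hk'] at hr
        exact out_ne_neg hb _ _ hr.symm
    have c2 : ¬ M (k - 1) := by
      intro hk
      rw [Mflip] at hk
      rcases Int.units_eq_one_or r with rfl | rfl
      · rw [mul_one, ← hk] at hr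
        exact out_ne_neg hb _ _ hr
      · rw [mul_neg, neg_neg, mul_one, hk] at hr
        exact out_ne_neg hb _ _ hr.symm
    obtain rfl : k = 0 := by
      by_contra hk0
      by_cases hkq : k < q
      · exact c1 (hM k h1 hkq)
      · by_cases hkp : -(p : ℤ) < k
        · exact c2 (hM (k - 1) (by omega) (by omega))
        · omega
    rcases hs with ⟨rfl, r', hr'⟩ | ⟨rfl, hr'⟩
    · rcases Int.units_eq_one_or r' with rfl | rfl
      · exact c1 (by simpa [M] using hr')
      · exact c2 ((Mflip 0).mpr (by simpa using hr'))
    · exact hr' r (by simpa using hr)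
  -- At an unmatched edge, an inverse letter in the source or a direct one in the target would need
  -- a partner because the coefficient is nonzero. The straight partner is excluded by assumption,
  -- the crossed one by `hcross`.
  have ends : ∀ (k : ℤ) (r : ℤˣ), -p ≤ k → k ≤ q →
      out hb (i₀ + k) r ≠ out hb (j₀ + s * k) (s * r) →
      (out hb (i₀ + k) r).direct = true ∧ (out hb (j₀ + s * k) (s * r)).direct = false := by
    intro k r h1 h2 hne
    have two : ∀ x y : ℤˣ, x = y ∨ x = -y := by decide
    constructor
    · by_contra hc
      obtain ⟨r', hr'⟩ := hφ.exists_out_eq_of_inverse (hF k h1 h2) (by simpa using hc)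
      rcases two r' (s * r) with rfl | rfl
      · exact hne hr'.symm
      · exact hcross k h1 h2 r hr'.symm
    · by_contra hc
      obtain ⟨r', hr'⟩ := hφ.exists_out_eq_of_direct (hF k h1 h2) (by simpa using hc)
      rcases two r' r with rfl | rfl
      · exact hne hr'
      · exact hcross k h1 h2 (-r) (by rw [hr', mul_neg, neg_neg])
  have endq := ends q 1 (by omega) le_rfl (by rw [mul_one]; exact hMq)
  have hs1 : s * -1 = -s := by rw [mul_neg, mul_one]
  have endp := ends (-p) (-1) le_rfl (by omega) (by
    rw [hs1]
    exact fun h => hMp ((Mflip (-p)).mpr h))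
  rw [mul_one] at endq
  rw [hs1] at endp
  -- The boundary letters have the directions that kill all four boundary terms of `window_arrowOp`,
  -- for any parameters `lam` and `ν`.
  refine ⟨window hb lam ν (i₀ - p) (j₀ - s * p) s (p + q), ⟨fun a x => ?_, fun f x => ?_⟩, ?_⟩
  · refine window_vertexOp hb lam ν _ _ s _ (fun k hk => ?_) a x
    have := hφ.src_eq (hF (k - p) (by omega) (by omega))
    rw [show i₀ - (p : ℤ) + k = i₀ + (k - p) by ring, this]
    congr 2
    ring
  · rw [window_arrowOp hb lam ν _ _ s _ (fun k hk => ?_) f x, if_neg, if_neg, if_neg, if_neg]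
    · simp
    · intro h'
      rw [show j₀ - (s : ℤ) * p + s * ((p + q : ℕ) : ℤ) = j₀ + s * q by push_cast; ring] at h'
      rw [h'] at endq
      simp at endq
    · intro h'
      rw [sub_eq_add_neg, ← mul_neg] at h'
      rw [h'] at endp
      simp at endp
    · intro h'
      rw [show i₀ - (p : ℤ) + ((p + q : ℕ) : ℤ) = i₀ + q by push_cast; ring] at h'
      rw [h'] at endq
      simp at endq
    · intro h'
      rw [sub_eq_add_neg] at h'
      rw [h'] at endp
      simp at endp
    · have := hM (k - p) (by omega) (by omega)
      have this' : out hb (i₀ + (k - p)) 1 = out hb (j₀ + s * (k - p)) s := this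
      rw [show i₀ - (p : ℤ) + k = i₀ + (k - p) by ring, this']
      congr 1
      ring
  · have := window_vec hb lam ν (i₀ - p) (j₀ - s * p) s (p + q) hpq (p := p) (by omega)
    simpa using this

end

end Band

namespace Band

noncomputable section

variable {K Q : Type u} [Field K] [Quiver.{u} Q] {R : Set (PathAlgebra K Q)}
  {b : List (Letter Q)}

/-! ### Coordinatewise maps -/

/-- Applying one map θ in every copy reduces compatibility with the whole quiver to commutation with
the letter matrices, that is, with the Jordan blocks. -/
theorem intertwines_compLeft {μ η : K} {n m : ℕ} (θ : (Fin n → K) →ₗ[K] (Fin m → K))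
    (h : ∀ i : Fin b.length, ∀ v, θ (letterMat b μ n i v) = letterMat b η m i (θ v)) :
    Intertwines b μ η (θ.compLeft (Fin b.length)) := by
  classical
  constructor
  · intro a x
    funext i
    rw [vertexOp_apply, LinearMap.compLeft_apply, LinearMap.compLeft_apply,
      Function.comp_apply, vertexOp_apply]
    split_ifs
    · rfl
    · exact map_zero θ
  · intro f x
    funext j
    obtain ⟨j, rfl⟩ := (Finite.injective_iff_surjective.mp (next_injective (b := b))) j
    rw [arrowOp_apply_next, LinearMap.compLeft_apply, Function.comp_apply, arrowOp_apply_next,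
      map_add, apply_ite θ, apply_ite θ, map_zero, h, h]
    rfl

/-- The extension by zero `K ^ n → K ^ (n + 1)`. -/
def snocZero (K : Type u) [Field K] (n : ℕ) : (Fin n → K) →ₗ[K] (Fin (n + 1) → K) where
  toFun v := Fin.snoc v 0
  map_add' v w := by
    funext i
    refine Fin.lastCases ?_ (fun i => ?_) i <;> simp
  map_smul' c v := by
    funext i
    refine Fin.lastCases ?_ (fun i => ?_) i <;> simp

/-- The last coordinate `K ^ (n + 1) → K ^ 1`. -/
def lastCoord (K : Type u) [Field K] (n : ℕ) : (Fin (n + 1) → K) →ₗ[K] (Fin 1 → K) :=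
  LinearMap.pi fun _ => LinearMap.proj (Fin.last n)

/-- The Jordan block is upper triangular, so the first `n` coordinates are stable under the block of
size `n + 1`, which restricts there to the block of size `n`. -/
theorem intertwines_snocZero (μ : K) (n : ℕ) :
    Intertwines b μ μ ((snocZero K n).compLeft (Fin b.length)) := by
  refine intertwines_compLeft _ fun i v => ?_
  unfold letterMat
  split_ifs
  · funext k
    simp only [Matrix.toLin'_apply, snocZero, LinearMap.coe_mk, AddHom.coe_mk]
    refine Fin.lastCases ?_ (fun k => ?_) k
    · rw [Fin.snoc_last, Matrix.mulVec, dotProduct, Fin.sum_univ_castSucc]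
      simp only [Fin.snoc_castSucc, Fin.snoc_last, mul_zero, add_zero]
      refine (Finset.sum_eq_zero fun l _ => ?_).symm
      have h1 : Fin.last n ≠ l.castSucc := (Fin.castSucc_lt_last l).ne'
      have h2 : n + 1 ≠ l.val := by have := l.isLt; omega
      simp [jordanBlock, h1, h2]
    · rw [Fin.snoc_castSucc, Matrix.mulVec, dotProduct, Matrix.mulVec, dotProduct,
        Fin.sum_univ_castSucc]
      simp [jordanBlock]
  · rfl

/-- The last row of the Jordan block has only its diagonal entry μ. -/
theorem intertwines_lastCoord (μ : K) (n : ℕ) :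
    Intertwines b μ μ ((lastCoord K n).compLeft (Fin b.length)) := by
  refine intertwines_compLeft _ fun i v => ?_
  unfold letterMat
  split_ifs
  · funext k
    simp only [Matrix.toLin'_apply, lastCoord, LinearMap.pi_apply, LinearMap.proj_apply]
    rw [Matrix.mulVec, dotProduct, Matrix.mulVec, dotProduct, Fin.sum_univ_castSucc,
      Finset.sum_eq_zero]
    · simp [jordanBlock, Subsingleton.elim k 0]
    · intro l _
      have h1 : Fin.last n ≠ l.castSucc := (Fin.castSucc_lt_last l).ne'
      have h2 : n + 1 ≠ l.val := by have := l.isLt; omega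
      simp [jordanBlock, h1, h2]
  · rfl

/-! ### Homomorphisms of band modules -/

/-- The path algebra lets a path of length one act as the arrow operator after the idempotent of its
source; this shows that the idempotent is harmless. -/
theorem arrowOp_vertexOp (hb : IsBand R b) (μ : K) (n : ℕ) (f : Quiver.Total Q)
    (x : Space K b n) : arrowOp b μ n f (vertexOp b n f.left x) = arrowOp b μ n f x := by
  have h : ∀ i, (b.get i).src = f.left → vertexOp b n f.left x i = x i := fun i hi => by
    rw [vertexOp_apply, if_pos hi]
  rw [arrowOp, LinearMap.sum_apply, LinearMap.sum_apply]
  refine Finset.sum_congr rfl fun i _ => ?_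
  rw [LinearMap.add_apply, LinearMap.add_apply]
  congr 1
  · split_ifs with hf
    · simp only [LinearMap.comp_apply, LinearMap.proj_apply]
      rw [h i (by rw [hf]; rfl)]
    · rfl
  · split_ifs with hf
    · simp only [LinearMap.comp_apply, LinearMap.proj_apply]
      rw [h (next i) (by rw [← tgt_eq hb, hf]; rfl)]
    · rfl

variable [Fintype Q] (hb : IsBand R b)

theorem pathRep_of (μ : K) (n : ℕ) (p : QPath Q) :
    pathRep hb μ n (PathAlgebra.of p) =
      PathAlgebra.evalPath (vertexOp b n) (arrowOp b μ n) p.path := by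
  rw [pathRep, PathAlgebra.lift_apply, PathAlgebra.linLift_of]

theorem pathRep_nil (μ : K) (n : ℕ) (a : Q) :
    pathRep hb μ n (PathAlgebra.of (QPath.nil a)) = vertexOp b n a := pathRep_of hb μ n _

theorem pathRep_toPath (μ : K) (n : ℕ) (f : Quiver.Total Q) :
    pathRep hb μ n (PathAlgebra.of ⟨f.left, f.right, f.hom.toPath⟩) = arrowOp b μ n f := by
  rw [pathRep_of]
  exact LinearMap.ext fun x => arrowOp_vertexOp hb μ n f x

/-- The quotient map from the path algebra to the bound quiver algebra. -/
abbrev mk (R : Set (PathAlgebra K Q)) : PathAlgebra K Q →+* BoundQuiverAlgebra R :=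
  (TwoSidedIdeal.span R).ringCon.mk'

theorem mk_surjective (R : Set (PathAlgebra K Q)) : Function.Surjective (mk R) :=
  RingCon.mk'_surjective _

/-- An element of the space of a band module, as an element of the band module. -/
def toMod (μ : Kˣ) (n : ℕ) : Space K b n ≃+ bandModule hb μ n :=
  AddEquiv.refl (Space K b n)

theorem mk_smul_toMod (μ : Kˣ) (n : ℕ) (y : PathAlgebra K Q) (x : Space K b n) :
    mk R y • toMod hb μ n x = toMod hb μ n (pathRep hb (μ : K) n y x) := rfl

/-- Scalars act on the band module only through the algebra. This identity makes its submodules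
subspaces and its homomorphisms K-linear. -/
theorem algebraMap_smul_toMod (μ : Kˣ) (n : ℕ) (c : K) (x : Space K b n) :
    mk R (algebraMap K _ c) • toMod hb μ n x = toMod hb μ n (c • x) := by
  rw [mk_smul_toMod, AlgHom.commutes]
  rfl

section

variable {hb} {μ η : Kˣ} {n m : ℕ}

/-- A submodule of a band module as a subspace. -/
def subspace (N : Submodule (BoundQuiverAlgebra R) (bandModule hb η m)) :
    Submodule K (Space K b m) where
  carrier := {x | toMod hb η m x ∈ N}
  add_mem' h h' := by
    rw [Set.mem_ofPred_eq, map_add]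
    exact N.add_mem h h'
  zero_mem' := by
    rw [Set.mem_ofPred_eq, map_zero]
    exact N.zero_mem
  smul_mem' c x h := by
    rw [Set.mem_ofPred_eq, ← algebraMap_smul_toMod]
    exact N.smul_mem _ h

variable (N : Submodule (BoundQuiverAlgebra R) (bandModule hb η m))

theorem mem_subspace {x : Space K b m} : x ∈ subspace N ↔ toMod hb η m x ∈ N := Iff.rfl

theorem arrowOp_mem_subspace (f : Quiver.Total Q) {x : Space K b m} (h : x ∈ subspace N) :
    arrowOp b (η : K) m f x ∈ subspace N := by
  rw [← pathRep_toPath hb, mem_subspace, ← mk_smul_toMod]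
  exact N.smul_mem _ h

/-- Compatibility modulo `N` needs checking only on generators: along a path each arrow adds an
error in `N` and carries the earlier error into `N`. -/
theorem pathRep_sub_mem (φ : Space K b n →ₗ[K] Space K b m)
    (hv : ∀ a x, φ (vertexOp b n a x) = vertexOp b m a (φ x))
    (ha : ∀ f x, φ (arrowOp b (μ : K) n f x) - arrowOp b (η : K) m f (φ x) ∈ subspace N)
    (y : PathAlgebra K Q) (x : Space K b n) :
    φ (pathRep hb (μ : K) n y x) - pathRep hb (η : K) m y (φ x) ∈ subspace N := by
  induction y using PathAlgebra.ind with
  | hof p =>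
    obtain ⟨a, c, p⟩ := p
    rw [pathRep_of, pathRep_of]
    change φ (PathAlgebra.evalPath (vertexOp b n) (arrowOp b (μ : K) n) p x) -
      PathAlgebra.evalPath (vertexOp b m) (arrowOp b (η : K) m) p (φ x) ∈ _
    induction p with
    | nil =>
      change φ (vertexOp b n a x) - vertexOp b m a (φ x) ∈ _
      rw [hv, sub_self]
      exact zero_mem _
    | cons p f ih =>
      rw [PathAlgebra.evalPath, PathAlgebra.evalPath, Module.End.mul_apply, Module.End.mul_apply]
      have := add_mem 
        (ha ⟨_, _, f⟩ (PathAlgebra.evalPath (vertexOp b n) (arrowOp b (μ : K) n) p x))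
        (arrowOp_mem_subspace N ⟨_, _, f⟩ ih)
      rwa [map_sub, sub_add_sub_cancel] at this
  | hz => simp
  | hadd y z hy hz =>
    have := add_mem hy hz
    rw [map_add, map_add, LinearMap.add_apply, LinearMap.add_apply, map_add]
    rwa [add_sub_add_comm]
  | hsmul c y hy =>
    rw [map_smul, map_smul, LinearMap.smul_apply, LinearMap.smul_apply, map_smul, ← smul_sub]
    exact (subspace N).smul_mem c hy

/-- A linear map that commutes with the vertices, and with the arrows up to elements of a
submodule, gives a homomorphism to the quotient by the submodule. -/
theorem exists_hom_quotient (φ : Space K b n →ₗ[K] Space K b m)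
    (hv : ∀ a x, φ (vertexOp b n a x) = vertexOp b m a (φ x))
    (ha : ∀ f x, φ (arrowOp b (μ : K) n f x) - arrowOp b (η : K) m f (φ x) ∈ subspace N) :
    ∃ ψ : bandModule hb μ n →ₗ[BoundQuiverAlgebra R] bandModule hb η m ⧸ N,
      ∀ x, ψ (toMod hb μ n x) = N.mkQ (toMod hb η m (φ x)) := by
  refine ⟨{ toFun := fun x => N.mkQ (toMod hb η m (φ ((toMod hb μ n).symm x)))
            map_add' := fun x y => by simp only [map_add]
            map_smul' := fun r x => ?_ }, fun x => ?_⟩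
  · obtain ⟨y, rfl⟩ := mk_surjective R r
    obtain ⟨x, rfl⟩ := (toMod hb μ n).surjective x
    rw [mk_smul_toMod, AddEquiv.symm_apply_apply, AddEquiv.symm_apply_apply, RingHom.id_apply,
      ← map_smul, mk_smul_toMod, ← sub_eq_zero, ← map_sub, ← map_sub, Submodule.mkQ_apply,
      Submodule.Quotient.mk_eq_zero]
    exact pathRep_sub_mem N φ hv ha y x
  · change N.mkQ (toMod hb η m (φ ((toMod hb μ n).symm (toMod hb μ n x)))) = _
    rw [AddEquiv.symm_apply_apply]

/-- A linear map that commutes with the vertices and the arrows is a homomorphism. -/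
def Intertwines.hom {φ : Space K b n →ₗ[K] Space K b m} (hφ : Intertwines b (μ : K) η φ) :
    bandModule hb μ n →ₗ[BoundQuiverAlgebra R] bandModule hb η m where
  toFun x := toMod hb η m (φ ((toMod hb μ n).symm x))
  map_add' x y := by simp only [map_add]
  map_smul' r x := by
    obtain ⟨y, rfl⟩ := mk_surjective R r
    obtain ⟨x, rfl⟩ := (toMod hb μ n).surjective x
    rw [mk_smul_toMod, AddEquiv.symm_apply_apply, AddEquiv.symm_apply_apply, RingHom.id_apply,
      mk_smul_toMod, ← sub_eq_zero, ← map_sub]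
    have := pathRep_sub_mem (μ := μ) (n := n) (⊥ : Submodule (BoundQuiverAlgebra R) (bandModule hb η m))
      φ hφ.vertex (fun f x => by rw [hφ.arrow, sub_self]; exact zero_mem _) y x
    exact this

theorem Intertwines.hom_toMod {φ : Space K b n →ₗ[K] Space K b m}
    (hφ : Intertwines b (μ : K) η φ) (x : Space K b n) :
    hφ.hom (hb := hb) (toMod hb μ n x) = toMod hb η m (φ x) := rfl

/-- The linear map underlying a homomorphism of band modules. -/
def toLin (ψ : bandModule hb μ n →ₗ[BoundQuiverAlgebra R] bandModule hb η m) :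
    Space K b n →ₗ[K] Space K b m where
  toFun x := (toMod hb η m).symm (ψ (toMod hb μ n x))
  map_add' x y := by simp only [map_add]
  map_smul' c x := by
    rw [AddEquiv.symm_apply_eq, ← algebraMap_smul_toMod, map_smul, RingHom.id_apply,
      ← algebraMap_smul_toMod, AddEquiv.apply_symm_apply]

theorem toMod_toLin (ψ : bandModule hb μ n →ₗ[BoundQuiverAlgebra R] bandModule hb η m)
    (x : Space K b n) : toMod hb η m (toLin ψ x) = ψ (toMod hb μ n x) := rfl

theorem intertwines_toLin (ψ : bandModule hb μ n →ₗ[BoundQuiverAlgebra R] bandModule hb η m) :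
    Intertwines b (μ : K) η (toLin ψ) := by
  have h : ∀ y x, toLin ψ (pathRep hb (μ : K) n y x) = pathRep hb (η : K) m y (toLin ψ x) := by
    intro y x
    apply (toMod hb η m).injective
    rw [toMod_toLin, ← mk_smul_toMod, map_smul, ← toMod_toLin, mk_smul_toMod]
  constructor
  · intro a x
    have := h (PathAlgebra.of (QPath.nil a)) x
    rwa [pathRep_nil, pathRep_nil] at this
  · intro f x
    have := h (PathAlgebra.of ⟨f.left, f.right, f.hom.toPath⟩) x
    rwa [pathRep_toPath, pathRep_toPath] at this

end

theorem toMod_vec_ne_zero (μ : Kˣ) (k : ℤ) : toMod hb μ 1 (vec hb μ k) ≠ 0 := by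
  intro h
  have h' : vec hb μ k = 0 := (toMod hb μ 1).injective (h.trans (map_zero _).symm)
  have := coord_vec_self hb μ k
  rw [h', map_zero] at this
  exact zero_ne_one this

end

end Band

/-! ### Finite generation under equivalences and bricks -/

/-- An equivalence between module categories preserves noetherian modules. -/
theorem isNoetherian_functor_obj {A B : Type u} [Ring A] [Ring B]
    (e : ModuleCat.{u} B ≌ ModuleCat.{u} A) (M : ModuleCat.{u} B) [IsNoetherian B M] :
    IsNoetherian A (e.functor.obj M) := by
  -- The submodule lattice is the lattice of subobjects, which an equivalence preserves; the
  -- ascending chain condition is read off from it.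
  have f : Submodule B M ≃o Submodule A (e.functor.obj M) :=
    (ModuleCat.subobjectModule M).symm.trans
      ((Subobject.lowerEquivalence (MonoOver.congr M e)).toOrderIso.trans
        (ModuleCat.subobjectModule (e.functor.obj M)))
  rw [isNoetherian_iff'] at *
  exact f.symm.toOrderEmbedding.wellFoundedGT

theorem isBrick_functor_obj_iff {C D : Type*} [Category C] [Category D] [Preadditive C]
    [Preadditive D] (e : C ≌ D) [e.functor.Additive] (X : C) :
    IsBrick (e.functor.obj X) ↔ IsBrick X := by
  let φ : End X ≃* End (e.functor.obj X) := e.fullyFaithfulFunctor.mulEquivEnd X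
  have h0 : ∀ f, φ f = 0 ↔ f = 0 := fun _ => e.functor.map_eq_zero_iff
  constructor
  · rintro ⟨h1, h2⟩
    refine ⟨φ.toEquiv.nontrivial, fun f hf => ?_⟩
    exact (MulEquiv.isUnit_map φ).mp (h2 (φ f) (fun h => hf ((h0 f).mp h)))
  · rintro ⟨h1, h2⟩
    refine ⟨φ.symm.toEquiv.nontrivial, fun f hf => ?_⟩
    obtain ⟨g, rfl⟩ := φ.surjective f
    exact (MulEquiv.isUnit_map φ).mpr (h2 g (fun h => hf ((h0 g).mpr h)))

/-- The finitely generated modules without nonzero homomorphisms to the members of a family form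
a torsion class. -/
theorem isTorsionClass_of_hom_eq_zero {A : Type u} [Ring A] {ι : Type*}
    (Y : ι → ModuleCat.{u} A) :
    IsTorsionClass fun X : ModuleCat.{u} A =>
      Module.Finite A X ∧ ∀ i, ∀ f : X ⟶ Y i, f = 0 where
  finite M h := h.1
  zero := ⟨ModuleCat.of A PUnit, ModuleCat.isZero_of_subsingleton _, inferInstance,
    fun i f => (ModuleCat.isZero_of_subsingleton _).eq_of_src f 0⟩
  quotients := ⟨fun {X X'} f _ hX => by
    obtain ⟨h1, h2⟩ := hX
    refine ⟨Module.Finite.of_surjective f.hom ((ModuleCat.epi_iff_surjective f).mp ‹_›),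
      fun i g => ?_⟩
    rw [← cancel_epi f, h2 i (f ≫ g), Limits.comp_zero]⟩
  extensions := ⟨fun {S} hS h1 h3 => by
    have := hS.epi_g
    have := hS.mono_f
    refine ⟨?_, fun i g => ?_⟩
    · have e1 := h1.1
      have e3 := h3.1
      have ex := (ShortComplex.ShortExact.moduleCat_exact_iff_function_exact S).mp hS.exact
      have e4 : Module.Finite A (LinearMap.ker S.g.hom) := by
        rw [LinearMap.exact_iff.mp ex]
        exact Module.Finite.range S.f.hom
      have e5 : Module.Finite A (S.X₂ ⧸ LinearMap.ker S.g.hom) :=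
        Module.Finite.equiv (S.g.hom.quotKerEquivOfSurjective
          ((ModuleCat.epi_iff_surjective S.g).mp ‹_›)).symm
      exact Module.Finite.of_submodule_quotient (LinearMap.ker S.g.hom)
    -- A map out of the middle term vanishes on the left term, hence factors through the right term,
    -- where it vanishes too.
    · have hfg : S.f ≫ g = 0 := h1.2 i _
      rw [← hS.exact.g_desc g hfg, h3.2 i (hS.exact.desc g hfg), Limits.comp_zero]⟩

/-! ### The three assertions over the bound quiver algebra -/

namespace Band

variable {K Q : Type u} [Field K] [Quiver.{u} Q] [Fintype Q] {R : Set (PathAlgebra K Q)}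
  {b : List (Letter Q)} (hb : IsBand R b)

theorem isNoetherian_bandModule (μ : Kˣ) (n : ℕ) :
    IsNoetherian (BoundQuiverAlgebra R) (bandModule hb μ n) := by
  rw [isNoetherian_iff']
  have h : WellFoundedGT (Submodule K (Space K b n)) := inferInstance
  let f : Submodule (BoundQuiverAlgebra R) (bandModule hb μ n) ↪o Submodule K (Space K b n) :=
    OrderEmbedding.ofMapLEIff subspace fun _ _ => Iff.rfl
  exact f.wellFoundedGT

/-- `M(b, μ, n + 1)` is an extension of `M(b, μ, 1)` by `M(b, μ, n)`. -/
theorem exists_shortExact (μ : Kˣ) (n : ℕ) :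
    ∃ S : ShortComplex (ModuleCat.{u} (BoundQuiverAlgebra R)), S.ShortExact ∧
      S.X₁ = bandModule hb μ n ∧ S.X₂ = bandModule hb μ (n + 1) ∧ S.X₃ = bandModule hb μ 1 := by
  have h1 := intertwines_snocZero (b := b) (μ : K) n
  have h2 := intertwines_lastCoord (b := b) (μ : K) n
  have h0 : (h2.hom (hb := hb)).comp h1.hom = 0 := by
    refine LinearMap.ext fun x => ?_
    obtain ⟨x, rfl⟩ := (toMod hb μ n).surjective x
    rw [LinearMap.comp_apply, h1.hom_toMod, h2.hom_toMod]
    refine (congrArg (toMod hb μ 1) (?_ : _ = (0 : Space K b 1))).trans (map_zero _)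
    funext i k
    simp [snocZero, lastCoord]
  refine ⟨ModuleCat.shortComplexOfCompEqZero _ _ h0,
    ModuleCat.shortComplex_shortExact _ ?_ ?_ ?_, rfl, rfl, rfl⟩
  · intro x
    obtain ⟨x, rfl⟩ := (toMod hb μ (n + 1)).surjective x
    constructor
    · intro h
      have h' : (lastCoord K n).compLeft (Fin b.length) x = 0 := (toMod hb μ 1).injective h
      refine ⟨toMod hb μ n fun i k => x i k.castSucc, ?_⟩
      refine congrArg (toMod hb μ (n + 1)) ?_
      funext i k
      refine Fin.lastCases ?_ (fun k => ?_) k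
      · have := congrFun (congrFun h' i) 0
        simp only [LinearMap.compLeft_apply, Function.comp_apply] at this
        simpa [snocZero, lastCoord] using this.symm
      · simp [snocZero]
    · rintro ⟨y, hy⟩
      rw [← hy]
      exact LinearMap.congr_fun h0 y
  · intro x y hxy
    obtain ⟨x, rfl⟩ := (toMod hb μ n).surjective x
    obtain ⟨y, rfl⟩ := (toMod hb μ n).surjective y
    have h : (snocZero K n).compLeft (Fin b.length) x = (snocZero K n).compLeft (Fin b.length) y :=
      (toMod hb μ (n + 1)).injective hxy
    refine congrArg _ (funext fun i => funext fun k => ?_)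
    have := congrFun (congrFun h i) k.castSucc
    simpa [snocZero] using this
  · intro y
    obtain ⟨y, rfl⟩ := (toMod hb μ 1).surjective y
    refine ⟨toMod hb μ (n + 1) fun i _ => y i 0, congrArg (toMod hb μ 1) ?_⟩
    funext i k
    simp [lastCoord, Subsingleton.elim k 0]

/-- A class closed under quotients and extensions that contains `M(b, μ, 1)` contains all
`M(b, μ, n)`. -/
theorem prop_bandModule (T : ObjectProperty (ModuleCat.{u} (BoundQuiverAlgebra R)))
    [T.IsClosedUnderQuotients] [T.IsClosedUnderExtensions] (μ : Kˣ)
    (h : T (bandModule hb μ 1)) (n : ℕ) : T (bandModule hb μ n) := by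
  induction n with
  | zero =>
    have : Subsingleton (bandModule hb μ 0) :=
      (toMod hb μ 0).symm.injective.subsingleton
    have : Epi (0 : bandModule hb μ 1 ⟶ bandModule hb μ 0) := by
      rw [ModuleCat.epi_iff_surjective]
      exact Function.surjective_to_subsingleton _
    exact T.prop_of_epi (0 : bandModule hb μ 1 ⟶ bandModule hb μ 0) h
  | succ n ih =>
    obtain ⟨S, hS, e1, e2, e3⟩ := exists_shortExact hb μ n
    rw [← e1] at ih
    rw [← e3] at h
    rw [← e2]
    exact T.prop_X₂_of_shortExact hS ih h

/-- If a submodule of `M(b, η, 1)` contains a basis vector, then the quotient by it is a quotient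
of any `M(b, μ, 1)`. -/
theorem exists_surjective_quotient (μ η : Kˣ) (j : ℤ)
    (N : Submodule (BoundQuiverAlgebra R) (bandModule hb η 1))
    (hj : toMod hb η 1 (vec hb η j) ∈ N) :
    ∃ ψ : bandModule hb μ 1 →ₗ[BoundQuiverAlgebra R] bandModule hb η 1 ⧸ N,
      Function.Surjective ψ := by
  classical
  have ht := length_pos hb
  -- The window of one full period starting at `j` matches the word with itself; it can fail to
  -- commute with arrows only at the seam between `j + L` and `j + L + 1`, where the two parameters
  -- enter.
  set L := b.length - 1
  have hper : j + (L : ℤ) + 1 = j + b.length * 1 := by omega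
  have hmem : ∀ k : ℤ, vec hb η (j + b.length * k) ∈ subspace N := fun k => by
    rw [vec_add_length]
    exact (subspace N).smul_mem _ hj
  have hjL : vec hb η (j + L + 1) ∈ subspace N := by rw [hper]; exact hmem 1
  have hstep : ∀ {k : ℤ} {s : ℤˣ} {f : Quiver.Total Q}, vec hb η k ∈ subspace N →
      out hb k s = ⟨f, true⟩ → vec hb η (k + s) ∈ subspace N := by
    intro k s f hk hs
    rw [← arrowOp_vec_of hb η hs]
    exact arrowOp_mem_subspace N f hk
  obtain ⟨ψ, hψ⟩ := exists_hom_quotient (μ := μ) N (window hb μ η j j 1 L)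
    (fun a x => window_vertexOp hb μ η j j 1 L (by simp) a x)
    (fun f x => by
      rw [window_arrowOp hb μ η j j 1 L (by simp) f x, add_assoc, add_sub_assoc, add_sub_assoc,
        add_sub_cancel_left]
      have ite_mem : ∀ (p : Prop) [Decidable p] (c : K) (v : Space K b 1),
          (p → v ∈ subspace N) → (if p then c • v else 0) ∈ subspace N := by
        intro p _ c v hv
        split_ifs with hp
        · exact (subspace N).smul_mem c (hv hp)
        · exact zero_mem _
      -- Every boundary term is a multiple of a vector at a position congruent to `j`, or of one
      -- obtained from such a vector by an arrow across the seam. All of these lie in `N`.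
      refine sub_mem (sub_mem (add_mem ?_ ?_) ?_) ?_
      · exact ite_mem _ _ _ fun _ => hj
      · refine ite_mem _ _ _ fun hx => ?_
        have h1 := out_add_of_eq hb hx
        have h2 := hstep (s := -1) hjL h1
        simpa using h2
      · refine ite_mem _ _ _ fun hx => ?_
        have h2 := hstep hj hx
        simpa [sub_eq_add_neg] using h2
      · refine ite_mem _ _ _ fun _ => ?_
        simpa using hjL)
  refine ⟨ψ, fun y => ?_⟩
  obtain ⟨y, rfl⟩ := N.mkQ_surjective y
  obtain ⟨y, rfl⟩ := (toMod hb η 1).surjective y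
  obtain ⟨x, rfl⟩ := window_surjective hb μ η j j y
  exact ⟨_, hψ x⟩

/-- If `M(b, lam, 1)` is not a brick, then it has an endomorphism with an off-diagonal
coefficient. -/
theorem exists_coord_ne_zero_of_not_isBrick {lam : Kˣ} (h : ¬ IsBrick (bandModule hb lam 1)) :
    ∃ φ : Space K b 1 →ₗ[K] Space K b 1, Intertwines b (lam : K) lam φ ∧
      ∃ i j : ℤ, ¬ (b.length : ℤ) ∣ j - i ∧ coord hb lam j (φ (vec hb lam i)) ≠ 0 := by
  by_contra! hc
  refine h ⟨?_, fun f hf => ?_⟩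
  · refine ⟨0, 1, fun h01 => toMod_vec_ne_zero hb lam 0 ?_⟩
    have h2 := LinearMap.congr_fun (congrArg ModuleCat.Hom.hom h01) (toMod hb lam 1 (vec hb lam 0))
    exact h2.symm
  · have hφ := intertwines_toLin f.hom
    have hs := hφ.eq_smul (hc _ hφ)
    set c := coord hb lam 0 (toLin f.hom (vec hb lam 0))
    have hc0 : c ≠ 0 := by
      intro h0
      rw [h0, zero_smul] at hs
      apply hf
      refine ModuleCat.hom_ext (LinearMap.ext fun x => ?_)
      obtain ⟨x, rfl⟩ := (toMod hb lam 1).surjective x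
      rw [← toMod_toLin, hs, LinearMap.zero_apply, map_zero]
      rfl
    rw [isUnit_iff_isIso, ConcreteCategory.isIso_iff_bijective]
    have key : ∀ x, f.hom (toMod hb lam 1 x) = toMod hb lam 1 (c • x) := by
      intro x
      rw [← toMod_toLin, hs]
      rfl
    constructor
    · intro x y hxy
      obtain ⟨x, rfl⟩ := (toMod hb lam 1).surjective x
      obtain ⟨y, rfl⟩ := (toMod hb lam 1).surjective y
      have hxy' : f.hom (toMod hb lam 1 x) = f.hom (toMod hb lam 1 y) := hxy
      rw [key, key, (toMod hb lam 1).injective.eq_iff] at hxy'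
      exact congrArg _ (smul_right_injective _ hc0 hxy')
    · intro y
      obtain ⟨y, rfl⟩ := (toMod hb lam 1).surjective y
      refine ⟨toMod hb lam 1 (c⁻¹ • y), (key _).trans ?_⟩
      rw [smul_inv_smul₀ hc0]

/-- If `M(b, lam, 1)` is not a brick, then a class closed under quotients and extensions that
contains it contains the whole family. -/
theorem prop_bandModule_of_not_isBrick
    (T : ObjectProperty (ModuleCat.{u} (BoundQuiverAlgebra R)))
    [T.IsClosedUnderQuotients] [T.IsClosedUnderExtensions] {lam : Kˣ}
    (hbrick : ¬ IsBrick (bandModule hb lam 1)) (h : T (bandModule hb lam 1)) (μ : Kˣ) :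
    T (bandModule hb μ 1) := by
  obtain ⟨φ, hφ, i, j, hd, h0⟩ := exists_coord_ne_zero_of_not_isBrick hb hbrick
  obtain ⟨ψ, hψ, hij⟩ := hφ.exists_hom hb hd h0 lam μ
  let g : bandModule hb lam 1 →ₗ[BoundQuiverAlgebra R] bandModule hb μ 1 := hψ.hom
  have hj : toMod hb μ 1 (vec hb μ j) ∈ LinearMap.range g :=
    ⟨toMod hb lam 1 (vec hb lam i), by rw [← hij]; rfl⟩
  -- The image of `g` and, by this surjection, its cokernel are both quotients of M(b, lam, 1); the
  -- target of `g` is their extension.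
  obtain ⟨p, hp⟩ := exists_surjective_quotient hb lam μ j _ hj
  let S := ModuleCat.shortComplexOfCompEqZero (LinearMap.range g).subtype
    (LinearMap.range g).mkQ (by ext; simp)
  have hS : S.ShortExact := ModuleCat.shortComplex_shortExact S
    (LinearMap.exact_subtype_mkQ _) (LinearMap.range g).injective_subtype
    (LinearMap.range g).mkQ_surjective
  have : Epi (ModuleCat.ofHom g.rangeRestrict) :=
    (ModuleCat.epi_iff_surjective _).mpr g.surjective_rangeRestrict
  have : Epi (ModuleCat.ofHom p) := (ModuleCat.epi_iff_surjective _).mpr hp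
  have h1 : T S.X₁ := T.prop_of_epi (ModuleCat.ofHom g.rangeRestrict) h
  have h3 : T S.X₃ := T.prop_of_epi (ModuleCat.ofHom p) h
  exact T.prop_X₂_of_shortExact hS h1 h3

/-- If `M(b, lam, 1)` is a brick, then there are no nonzero homomorphisms between different
members of the family. -/
theorem hom_eq_zero_of_isBrick [IsAlgClosed K] {lam : Kˣ}
    (hbrick : IsBrick (bandModule hb lam 1)) {μ η : Kˣ} (hμη : μ ≠ η)
    (f : bandModule hb μ 1 ⟶ bandModule hb η 1) : f = 0 := by
  have hφ := intertwines_toLin f.hom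
  have hzero : toLin f.hom = 0 := by
    refine hφ.eq_zero hμη (hb := hb) fun i j hd => ?_
    by_contra h0
    -- The off-diagonal coefficient found between the parameters μ and η is transferred to an
    -- endomorphism of the brick.
    obtain ⟨ψ, hψ, hij⟩ := hφ.exists_hom hb hd h0 lam lam
    have : Nontrivial (Space K b 1) :=
      ⟨vec hb lam 0, 0, fun h => toMod_vec_ne_zero hb lam 0 (by rw [h, map_zero])⟩
    obtain ⟨c, hc⟩ := Module.End.exists_eigenvalue (K := K) (V := Space K b 1) ψ
    obtain ⟨v, hv⟩ := hc.exists_hasEigenvector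
    -- Subtracting an eigenvalue gives an endomorphism with nonzero kernel, which must vanish on a
    -- brick. Then ψ is a scalar and cannot send `vec i` to the incongruent `vec j`.
    have hχ : Intertwines b (lam : K) lam (ψ - c • LinearMap.id) := by
      constructor
      · intro a x
        simp only [LinearMap.sub_apply, LinearMap.smul_apply, LinearMap.id_apply, map_sub,
          map_smul, hψ.vertex]
      · intro a x
        simp only [LinearMap.sub_apply, LinearMap.smul_apply, LinearMap.id_apply, map_sub,
          map_smul, hψ.arrow]
    let g : End (bandModule hb lam 1) := ModuleCat.ofHom
      (X := bandModule hb lam 1) (Y := bandModule hb lam 1) hχ.hom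
    have hg : g = 0 := by
      by_contra hg0
      have hu := hbrick.isUnit g hg0
      rw [isUnit_iff_isIso, ConcreteCategory.isIso_iff_bijective] at hu
      have e1 : hχ.hom (hb := hb) (toMod hb lam 1 v) = 0 := by
        rw [hχ.hom_toMod, LinearMap.sub_apply, LinearMap.smul_apply, LinearMap.id_apply,
          hv.apply_eq_smul, sub_self, map_zero]
      have e2 : toMod hb lam 1 v = 0 := hu.1 (e1.trans (map_zero (hχ.hom (hb := hb))).symm)
      exact hv.2 ((toMod hb lam 1).injective (e2.trans (map_zero _).symm))
    have e3 : (ψ - c • LinearMap.id : Space K b 1 →ₗ[K] Space K b 1) (vec hb lam i) = 0 :=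
      (toMod hb lam 1).injective (LinearMap.congr_fun (congrArg ModuleCat.Hom.hom hg)
        (toMod hb lam 1 (vec hb lam i)))
    rw [LinearMap.sub_apply, hij, sub_eq_zero] at e3
    have e4 := congrArg (coord hb lam j) e3
    rw [coord_vec_self, LinearMap.smul_apply, map_smul, LinearMap.id_apply,
      coord_vec_of_not_dvd hb lam hd, smul_zero] at e4
    exact one_ne_zero e4
  refine ModuleCat.hom_ext (LinearMap.ext fun x => ?_)
  obtain ⟨x, rfl⟩ := (toMod hb μ 1).surjective x
  rw [← toMod_toLin, hzero, LinearMap.zero_apply, map_zero]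
  rfl

theorem id_bandModule_ne_zero (μ : Kˣ) : 𝟙 (bandModule hb μ 1) ≠ 0 := fun h =>
  toMod_vec_ne_zero hb μ 0 (LinearMap.congr_fun (congrArg ModuleCat.Hom.hom h)
    (toMod hb μ 1 (vec hb μ 0)))

end Band

/-! ### Transport along the Morita equivalence -/

theorem theorem1p4 {K : Type u} [Field K] [IsAlgClosed K]
    {Q : Type u} [Quiver.{u} Q] [Fintype Q] [∀ a c : Q, Finite (a ⟶ c)]
    (R : Set (PathAlgebra K Q)) (hR : IsAdmissible (TwoSidedIdeal.span R))
    {A : Type u} [Ring A] [Algebra K A] [Module.Finite K A]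
    (e : MoritaEquivalence K (BoundQuiverAlgebra R) A)
    {b : List (Letter Q)} (hb : IsBand R b) (lam : Kˣ) :
    (∀ T : ObjectProperty (ModuleCat.{u} A), IsTorsionClass T →
      T (e.eqv.functor.obj (bandModule hb lam 1)) →
        ∀ n : ℕ, T (e.eqv.functor.obj (bandModule hb lam n))) ∧
    (¬ IsBrick (e.eqv.functor.obj (bandModule hb lam 1)) →
      ∀ T : ObjectProperty (ModuleCat.{u} A), IsTorsionClass T →
        T (e.eqv.functor.obj (bandModule hb lam 1)) →
          ∀ μ : Kˣ, T (e.eqv.functor.obj (bandModule hb μ 1))) ∧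
    (IsBrick (e.eqv.functor.obj (bandModule hb lam 1)) →
      ∃ T : Kˣ → ObjectProperty (ModuleCat.{u} A),
        (∀ μ : Kˣ, IsTorsionClass (T μ)) ∧ Function.Injective T ∧ (Set.range T).Infinite ∧
          ∀ μ η : Kˣ, T μ (e.eqv.functor.obj (bandModule hb η 1)) ↔ η = μ) := by
  have hbrick := isBrick_functor_obj_iff e.eqv (bandModule hb lam 1)
  refine ⟨fun T hT h n => ?_, fun hnot T hT h μ => ?_, fun hyes => ?_⟩
  · have := hT.quotients
    have := hT.extensions
    -- The preimage of a torsion class under the exact functor `e.eqv.functor` is still closed under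
    -- quotients and extensions, which is all that is needed over the bound quiver algebra.
    exact Band.prop_bandModule hb (T.inverseImage e.eqv.functor) lam h n
  · have := hT.quotients
    have := hT.extensions
    exact Band.prop_bandModule_of_not_isBrick hb (T.inverseImage e.eqv.functor)
      (fun h' => hnot (hbrick.mpr h')) h μ
  · let F : Kˣ → ModuleCat.{u} A := fun η => e.eqv.functor.obj (bandModule hb η 1)
    -- The class is left orthogonal to all the other members of the family: it contains its own
    -- member by Hom-orthogonality, and excludes the others because of their identity maps.
    let T : Kˣ → ObjectProperty (ModuleCat.{u} A) := fun μ X =>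
      Module.Finite A X ∧ ∀ η : {η : Kˣ // η ≠ μ}, ∀ f : X ⟶ F η, f = 0
    have hT : ∀ μ η : Kˣ, T μ (F η) ↔ η = μ := by
      intro μ η
      constructor
      · intro h
        by_contra hne
        refine Band.id_bandModule_ne_zero hb η ?_
        rw [← e.eqv.functor.map_eq_zero_iff]
        exact h.2 ⟨η, hne⟩ _
      · rintro rfl
        have := Band.isNoetherian_bandModule hb η 1
        have : IsNoetherian A (F η) := isNoetherian_functor_obj e.eqv _
        refine ⟨inferInstance, fun ν f => ?_⟩
        obtain ⟨g, rfl⟩ := e.eqv.functor.map_surjective f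
        rw [Band.hom_eq_zero_of_isBrick hb (hbrick.mp hyes) ν.2.symm g, Functor.map_zero]
    have hinj : Function.Injective T := fun μ η h =>
      (hT η μ).mp (h ▸ (hT μ μ).mpr rfl)
    have : Infinite {x : K // x ≠ 0} := (Set.finite_singleton (0 : K)).infinite_compl.to_subtype
    have : Infinite Kˣ := unitsEquivNeZero.infinite_iff.mpr this
    exact ⟨T, fun μ => isTorsionClass_of_hom_eq_zero _, hinj, Set.infinite_range_of_injective hinj,
      hT⟩
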